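/- Let $X$ be a regular scheme that is projective over $\operatorname{Spec}\mathbb{Z}$, i.e. $X$ admits a closed immersion into some projective space $\mathbb{P}^n_{\mathbb{Z}}$. For a closed immersion $k\colon X\to Y$ into a scheme $Y$, with ideal sheaf $I_k\subset\mathcal{O}_Y$, let $C_{X,k}$ denote the two-term complex of $\mathcal{O}_X$-modules $$I_k/I_k^2\longrightarrow k^*\Omega_{Y/\mathbb{Z}},\qquad s\mapsto ds,$$ with $k^*\Omega_{Y/\mathbb{Z}}=\Omega_{Y/\mathbb{Z}}|_X$ in degree $0$ and $I_k/I_k^2=k^*I_k$ in homological degree $1$. Let $D(X)$ be the derived category of locally free sheaves on $X$: the localization of the category of bounded complexes of locally free $\mathcal{O}_X$-modules of finite rank at the quasi-isomorphisms. (1) For every closed immersion $i\colon X\to\mathbb{P}^n_{\mathbb{Z}}$, both $I_i/I_i^2$ and $i^*\Omega_{\mathbb{P}^n_{\mathbb{Z}}/\mathbb{Z}}$ are locally free of finite rank, so that $C_{X,i}$ defines an object of $D(X)$. (2) This object does not depend on the embedding, up to canonical isomorphism. That is, for any two closed immersions $i\colon X\to\mathbb{P}^n_{\mathbb{Z}}$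 and $j\colon X\to\mathbb{P}^m_{\mathbb{Z}}$ there is exactly one isomorphism $e\colon C_{X,i}\to C_{X,j}$ in $D(X)$ with the following property: for every closed immersion $k\colon X\to Y$ into a scheme $Y$ such that both terms of $C_{X,k}$ are locally free of finite rank, and all morphisms $f\colon Y\to\mathbb{P}^n_{\mathbb{Z}}$ and $g\colon Y\to\mathbb{P}^m_{\mathbb{Z}}$ with $f\circ k=i$ and $g\circ k=j$, one has $g^*\circ e=f^*$ in $D(X)$, where $f^*\colon C_{X,i}\to C_{X,k}$ and $g^*\colon C_{X,j}\to C_{X,k}$ are the morphisms of complexes induced by pulling back functions and differentials along $f$ and $g$. -/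

import Mathlib

open CategoryTheory Limits AlgebraicGeometry

namespace CotangentZ

open ZeroObject

noncomputable section

/-- Projective `n`-space over `ℤ`: `Proj` of `ℤ[x₀, …, xₙ]` graded by total degree. -/
def projectiveSpace (n : ℕ) : Scheme.{0} :=
  letI := MvPolynomial.gradedAlgebra (σ := Fin (n + 1)) (R := ℤ)
  Proj (MvPolynomial.homogeneousSubmodule (Fin (n + 1)) ℤ)

/-- The unique morphism from the constant presheaf `ℤ` to the structure presheaf. -/
def fromInt (Y : Scheme.{0}) :
    (Functor.const (TopologicalSpace.Opens Y)ᵒᵖ).obj (CommRingCat.of ℤ) ⟶ Y.presheaf where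
  app U := CommRingCat.ofHom (Int.castRingHom _)
  naturality U V f := by
    ext; simp

/-- The presheaf `U ↦ Ω_{Γ(Y, U)/ℤ}` of Kähler differentials. -/
abbrev presheafDifferentials (Y : Scheme.{0}) : Y.PresheafOfModules :=
  PresheafOfModules.DifferentialsConstruction.relativeDifferentials' (fromInt Y)

/-- The sheaf `Ω_{Y/ℤ}`: the sheafification of `U ↦ Ω_{Γ(Y, U)/ℤ}`. -/
def differentials (Y : Scheme.{0}) : Y.Modules :=
  (PresheafOfModules.sheafification (𝟙 Y.ringCatSheaf.obj)).obj (presheafDifferentials Y)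

open Scheme.Modules

/-- The structure sheaf, as a module over itself. -/
def structureSheaf (Y : Scheme.{0}) : Y.Modules := SheafOfModules.unit Y.ringCatSheaf

/-- The morphism `𝒪_Y ⟶ k_* 𝒪_X` of `𝒪_Y`-modules. -/
def structureMap {X Y : Scheme.{0}} (k : X ⟶ Y) :
    structureSheaf Y ⟶ (pushforward k).obj (structureSheaf X) :=
  SheafOfModules.unitToPushforwardObjUnit k.toRingCatSheafHom

/-- The ideal sheaf `I` of `k : X ⟶ Y`: the kernel of `𝒪_Y ⟶ k_* 𝒪_X`. -/
abbrev idealModule {X Y : Scheme.{0}} (k : X ⟶ Y) : Y.Modules := kernel (structureMap k)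

/-- The conormal sheaf `I/I²` as a sheaf on `X`, that is `k^* I` (for a closed immersion `k`,
`k^* I = k⁻¹(I ⊗ 𝒪_Y/I) = k⁻¹(I/I²)`). -/
abbrev conormal {X Y : Scheme.{0}} (k : X ⟶ Y) : X.Modules :=
  (Scheme.Modules.pullback k).obj (idealModule k)

/-- The sheaf `Ω_{Y/ℤ}|_X`, that is `k^* Ω_{Y/ℤ}`. -/
abbrev restrictedDifferentials {X Y : Scheme.{0}} (k : X ⟶ Y) : X.Modules :=
  (Scheme.Modules.pullback k).obj (differentials Y)

/-- The universal derivation `d : 𝒪_Y ⟶ Ω_{Y/ℤ}`. -/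
def univDerivation (Y : Scheme.{0}) : (differentials Y).val.Derivation' (fromInt Y) :=
  (PresheafOfModules.DifferentialsConstruction.derivation' (fromInt Y)).postcomp
    ((PresheafOfModules.sheafificationAdjunction (𝟙 Y.ringCatSheaf.obj)).unit.app
      (presheafDifferentials Y))

/-- The universal derivation on sections over `U`. -/
def sectionsD (Y : Scheme.{0}) (U : Y.Opens) : Γ(Y, U) →+ Γ(differentials Y, U) :=
  (univDerivation Y).d (X := .op U)

lemma sectionsD_mul {Y : Scheme.{0}} {U : Y.Opens} (a b : Γ(Y, U)) :
    sectionsD Y U (a * b) = a • sectionsD Y U b + b • sectionsD Y U a :=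
  (univDerivation Y).d_mul (X := .op U) a b

lemma sectionsD_map {Y : Scheme.{0}} {U V : Y.Opens} (f : V ⟶ U) (a : Γ(Y, U)) :
    sectionsD Y V (Y.presheaf.map f.op a) = (differentials Y).presheaf.map f.op (sectionsD Y U a) :=
  (univDerivation Y).d_map f.op a

/-- A morphism of sheaves of modules from compatible linear maps on sections. -/
def modHom {Y : Scheme.{0}} {M N : Y.Modules} (φ : ∀ U : Y.Opens, Γ(M, U) →+ Γ(N, U))
    (smul : ∀ (U : Y.Opens) (r : Γ(Y, U)) (s : Γ(M, U)), φ U (r • s) = r • φ U s)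
    (nat : ∀ (U V : Y.Opens) (f : V ⟶ U) (s : Γ(M, U)),
      φ V (M.presheaf.map f.op s) = N.presheaf.map f.op (φ U s)) : M ⟶ N :=
  ⟨PresheafOfModules.homMk
    { app := fun U => AddCommGrpCat.ofHom (φ U.unop)
      naturality := fun U V f => by
        ext s
        exact nat U.unop V.unop f.unop s }
    (fun U r s => smul U.unop r s)⟩

lemma app_map {Y : Scheme.{0}} {M N : Y.Modules} (φ : M ⟶ N) {U V : Y.Opens} (f : V ⟶ U)
    (s : Γ(M, U)) :
    φ.app V (M.presheaf.map f.op s) = N.presheaf.map f.op (φ.app U s) :=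
  ConcreteCategory.congr_hom (φ.mapPresheaf.naturality f.op) s

/-- A derivation with values in a sheaf of modules from compatible derivations on sections
(additive maps that satisfy the Leibniz rule). -/
def derivationOfSections {Y : Scheme.{0}} (M : Y.Modules)
    (d : ∀ U : Y.Opens, Γ(Y, U) →+ Γ(M, U))
    (mul : ∀ (U : Y.Opens) (a b : Γ(Y, U)), d U (a * b) = a • d U b + b • d U a)
    (nat : ∀ (U V : Y.Opens) (f : V ⟶ U) (a : Γ(Y, U)),
      d V (Y.presheaf.map f.op a) = M.presheaf.map f.op (d U a)) :
    M.val.Derivation' (fromInt Y) where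
  d := fun {U} => d U.unop
  d_mul := fun {U} a b => mul U.unop a b
  d_map := fun {U V} f a => nat U.unop V.unop f.unop a
  d_app := fun {U} a => by
    have h1 : d U.unop (1 : Γ(Y, U.unop)) = 0 := by
      simpa using mul U.unop 1 1
    have h2 : (fromInt Y).app U a = ((show ℤ from a) : Γ(Y, U.unop)) := rfl
    change d U.unop ((fromInt Y).app U a) = 0
    rw [h2, ← zsmul_one, map_zsmul, h1, smul_zero]

/-- The morphism `Ω_{Y/ℤ} ⟶ M` induced by a derivation `𝒪_Y ⟶ M`. -/
def descDifferentials {Y : Scheme.{0}} (M : Y.Modules) (d : ∀ U : Y.Opens, Γ(Y, U) →+ Γ(M, U))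
    (mul : ∀ (U : Y.Opens) (a b : Γ(Y, U)), d U (a * b) = a • d U b + b • d U a)
    (nat : ∀ (U V : Y.Opens) (f : V ⟶ U) (a : Γ(Y, U)),
      d V (Y.presheaf.map f.op a) = M.presheaf.map f.op (d U a)) : differentials Y ⟶ M :=
  ((PresheafOfModules.sheafificationAdjunction (𝟙 Y.ringCatSheaf.obj)).homEquiv
    (presheafDifferentials Y) M).symm
    ((PresheafOfModules.DifferentialsConstruction.isUniversal' (fromInt Y)).desc (M' := M.val)
      (derivationOfSections M d mul nat))

lemma descDifferentials_sectionsD {Y : Scheme.{0}} (M : Y.Modules)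
    (d : ∀ U : Y.Opens, Γ(Y, U) →+ Γ(M, U)) (mul nat) (U : Y.Opens) (a : Γ(Y, U)) :
    (descDifferentials M d mul nat).app U (sectionsD Y U a) = d U a := by
  have h := (PresheafOfModules.sheafificationAdjunction (𝟙 Y.ringCatSheaf.obj)).homEquiv
    (presheafDifferentials Y) M |>.apply_symm_apply
    ((PresheafOfModules.DifferentialsConstruction.isUniversal' (fromInt Y)).desc (M' := M.val)
      (derivationOfSections M d mul nat))
  replace h := (Adjunction.homEquiv_unit _ _ _ _).symm.trans h
  have h2 := (PresheafOfModules.DifferentialsConstruction.isUniversal' (fromInt Y)).fac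
    (derivationOfSections M d mul nat)
  have h3 := PresheafOfModules.Derivation.congr_d h2 (X := .op U) a
  refine Eq.trans ?_ h3
  exact ConcreteCategory.congr_hom (congrArg (fun φ => PresheafOfModules.Hom.app φ (.op U)) h)
    ((PresheafOfModules.DifferentialsConstruction.derivation' (fromInt Y)).d (X := .op U) a)

section
variable {X Y : Scheme.{0}} (k : X ⟶ Y)

/-- The inclusion `I ⊆ 𝒪_Y` on sections over `U`. -/
def idealIncl (U : Y.Opens) : Γ(idealModule k, U) →+ Γ(Y, U) :=
  (Hom.app (M := idealModule k) (N := structureSheaf Y) (kernel.ι (structureMap k)) U).hom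

lemma idealIncl_smul {U : Y.Opens} (a : Γ(Y, U)) (s : Γ(idealModule k, U)) :
    idealIncl k U (a • s) = a * idealIncl k U s :=
  Hom.app_smul (M := idealModule k) (N := structureSheaf Y) (kernel.ι (structureMap k)) a s

lemma idealIncl_map {U V : Y.Opens} (f : V ⟶ U) (s : Γ(idealModule k, U)) :
    idealIncl k V ((idealModule k).presheaf.map f.op s) =
      Y.presheaf.map f.op (idealIncl k U s) :=
  app_map (M := idealModule k) (N := structureSheaf Y) (kernel.ι (structureMap k)) f s

lemma app_idealIncl {U : Y.Opens} (s : Γ(idealModule k, U)) :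
    k.app U (idealIncl k U s) = 0 :=
  ConcreteCategory.congr_hom
    (congrArg (fun φ => Hom.app φ U) (kernel.condition (structureMap k))) s

/-- The morphism `Ω_{Y/ℤ} ⟶ k_* k^* Ω_{Y/ℤ}`. -/
def unitDifferentials :
    differentials Y ⟶ (pushforward k).obj (restrictedDifferentials k) :=
  (pullbackPushforwardAdjunction k).unit.app (differentials Y)

lemma smul_pushforward_eq_zero (M : X.Modules) {U : Y.Opens} (s : Γ(idealModule k, U))
    (x : Γ((pushforward k).obj M, U)) : idealIncl k U s • x = 0 := by
  have h : idealIncl k U s • x =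
    (show Γ((pushforward k).obj M, U) from
      k.app U (idealIncl k U s) • (show Γ(M, k ⁻¹ᵁ U) from x)) := rfl
  rw [h, app_idealIncl]
  exact zero_smul Γ(X, k ⁻¹ᵁ U) (show Γ(M, k ⁻¹ᵁ U) from x)

/-- The `𝒪_Y`-linear map `I ⟶ k_* k^* Ω_{Y/ℤ}` that sends `s` to the class of `ds`. -/
def conormalMapAux :
    idealModule k ⟶ (pushforward k).obj (restrictedDifferentials k) :=
  modHom (fun U => (((unitDifferentials k).app U).hom.comp (sectionsD Y U)).comp (idealIncl k U))
    (fun U r s => by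
      change (unitDifferentials k).app U (sectionsD Y U (idealIncl k U (r • s))) =
        r • (unitDifferentials k).app U (sectionsD Y U (idealIncl k U s))
      rw [idealIncl_smul, sectionsD_mul, map_add, Hom.app_smul, Hom.app_smul,
        smul_pushforward_eq_zero, add_zero])
    (fun U V f s => by
      change (unitDifferentials k).app V (sectionsD Y V (idealIncl k V
          ((idealModule k).presheaf.map f.op s))) = _
      rw [idealIncl_map, sectionsD_map, app_map]
      rfl)

/-- The `𝒪_X`-linear map `I/I² ⟶ Ω_{Y/ℤ}|_X` induced by `s ↦ ds`. -/
def conormalMap : conormal k ⟶ restrictedDifferentials k :=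
  ((pullbackPushforwardAdjunction k).homEquiv _ _).symm (conormalMapAux k)
end

section
variable {X Y Z : Scheme.{0}} (k : X ⟶ Y) (f : Y ⟶ Z)

/-- For `k : X ⟶ Y` and `f : Y ⟶ Z`, the map `s ↦ f^# s` from the ideal sheaf of `k ≫ f` to the
ideal sheaf of `k`. -/
def idealTransition : idealModule (k ≫ f) ⟶ (pushforward f).obj (idealModule k) :=
  kernel.lift ((pushforward f).map (structureMap k))
    (kernel.ι (structureMap (k ≫ f)) ≫ structureMap f)
    (by
      ext U s
      exact app_idealIncl (k ≫ f) (U := U) s) ≫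
    (PreservesKernel.iso (pushforward f) (structureMap k)).inv

lemma idealIncl_idealTransition (U : Z.Opens) (s : Γ(idealModule (k ≫ f), U)) :
    idealIncl k (f ⁻¹ᵁ U) ((idealTransition k f).app U s) = f.app U (idealIncl (k ≫ f) U s) := by
  have h : idealTransition k f ≫ (pushforward f).map (kernel.ι (structureMap k)) =
      kernel.ι (structureMap (k ≫ f)) ≫ structureMap f := by
    simp only [idealTransition, Category.assoc]
    rw [PreservesKernel.iso_inv_ι]
    exact kernel.lift_ι _ _ _
  exact ConcreteCategory.congr_hom (congrArg (fun φ => Hom.app φ U) h) s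

/-- The morphism `Ω_{Z/ℤ} ⟶ f_* Ω_{Y/ℤ}`, `da ↦ d(f^# a)`. -/
def differentialsTransition : differentials Z ⟶ (pushforward f).obj (differentials Y) :=
  descDifferentials _ (fun U => (sectionsD Y (f ⁻¹ᵁ U)).comp (f.app U).hom.toAddMonoidHom)
    (fun U a b => by
      change sectionsD Y (f ⁻¹ᵁ U) (f.app U (a * b)) = _
      rw [map_mul, sectionsD_mul]
      rfl)
    (fun U V g a => by
      change sectionsD Y (f ⁻¹ᵁ V) (f.app V (Z.presheaf.map g.op a)) = _
      have h : f.app V (Z.presheaf.map g.op a) =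
          Y.presheaf.map ((TopologicalSpace.Opens.map f.base).map g).op (f.app U a) :=
        ConcreteCategory.congr_hom (f.naturality g.op) a
      rw [h, sectionsD_map]
      rfl)

lemma differentialsTransition_sectionsD (U : Z.Opens) (a : Γ(Z, U)) :
    (differentialsTransition f).app U (sectionsD Z U a) = sectionsD Y (f ⁻¹ᵁ U) (f.app U a) :=
  descDifferentials_sectionsD _ _ _ _ U a

/-- The morphism `(k ≫ f)^* M ⟶ k^* N` induced by `φ : M ⟶ f_* N`, that is, the map adjoint to
`M ⟶ f_* N ⟶ f_* k_* k^* N = (k ≫ f)_* k^* N`. -/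
def pullbackTransition {M : Z.Modules} {N : Y.Modules} (φ : M ⟶ (pushforward f).obj N) :
    (Scheme.Modules.pullback (k ≫ f)).obj M ⟶ (Scheme.Modules.pullback k).obj N :=
  ((pullbackPushforwardAdjunction (k ≫ f)).homEquiv M ((Scheme.Modules.pullback k).obj N)).symm
    (φ ≫ (pushforward f).map ((pullbackPushforwardAdjunction k).unit.app N) ≫
      (pushforwardComp k f).hom.app ((Scheme.Modules.pullback k).obj N))

/-- The map `I_{k ≫ f}/I_{k ≫ f}² ⟶ I_k/I_k²` given by `s ↦ f^# s`. -/
def conormalTransition : conormal (k ≫ f) ⟶ conormal k :=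
  pullbackTransition k f (idealTransition k f)

/-- The map `Ω_{Z/ℤ}|_X ⟶ Ω_{Y/ℤ}|_X` given by `da ↦ d(f^# a)`. -/
def restrictedDifferentialsTransition :
    restrictedDifferentials (k ≫ f) ⟶ restrictedDifferentials k :=
  pullbackTransition k f (differentialsTransition f)

lemma hom_ext_of_unit {M : Y.Modules} {N : X.Modules}
    {a b : (Scheme.Modules.pullback k).obj M ⟶ N}
    (h : ∀ (U : Y.Opens) (m : Γ(M, U)),
      a.app (k ⁻¹ᵁ U) (((pullbackPushforwardAdjunction k).unit.app M).app U m) =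
        b.app (k ⁻¹ᵁ U) (((pullbackPushforwardAdjunction k).unit.app M).app U m)) : a = b := by
  apply ((pullbackPushforwardAdjunction k).homEquiv _ _).injective
  rw [Adjunction.homEquiv_unit, Adjunction.homEquiv_unit]
  ext U m
  exact h U m

lemma homEquiv_symm_app_unit {M : Y.Modules} {N : X.Modules} (φ : M ⟶ (pushforward k).obj N)
    (U : Y.Opens) (m : Γ(M, U)) :
    Hom.app (((pullbackPushforwardAdjunction k).homEquiv M N).symm φ) (k ⁻¹ᵁ U)
      (((pullbackPushforwardAdjunction k).unit.app M).app U m) = φ.app U m := by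
  have h := ((pullbackPushforwardAdjunction k).homEquiv M N).apply_symm_apply φ
  rw [Adjunction.homEquiv_unit] at h
  exact ConcreteCategory.congr_hom (congrArg (fun φ => Hom.app φ U) h) m

/-- The transition maps commute with the maps `I/I² ⟶ Ω|_X`. -/
lemma conormalMap_transition :
    conormalMap (k ≫ f) ≫ restrictedDifferentialsTransition k f =
      conormalTransition k f ≫ conormalMap k := by
  apply hom_ext_of_unit
  intro U m
  have h1 := homEquiv_symm_app_unit (k ≫ f) (conormalMapAux (k ≫ f)) U m
  have h2 := homEquiv_symm_app_unit (k ≫ f) (idealTransition k f ≫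
    (pushforward f).map ((pullbackPushforwardAdjunction k).unit.app _) ≫
      (pushforwardComp k f).hom.app ((Scheme.Modules.pullback k).obj _)) U m
  have h3 := homEquiv_symm_app_unit (k ≫ f) (differentialsTransition f ≫
    (pushforward f).map ((pullbackPushforwardAdjunction k).unit.app _) ≫
      (pushforwardComp k f).hom.app ((Scheme.Modules.pullback k).obj _)) U
      (sectionsD Z U (idealIncl (k ≫ f) U m))
  have h4 := homEquiv_symm_app_unit k (conormalMapAux k) (f ⁻¹ᵁ U) ((idealTransition k f).app U m)
  have h5 := differentialsTransition_sectionsD f U (idealIncl (k ≫ f) U m)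
  have h6 := idealIncl_idealTransition k f U m
  exact (congrArg ((restrictedDifferentialsTransition k f).app ((k ≫ f) ⁻¹ᵁ U)) h1).trans
    (h3.trans ((congrArg ((unitDifferentials k).app (f ⁻¹ᵁ U))
      (h5.trans (congrArg (sectionsD Y (f ⁻¹ᵁ U)) h6.symm))).trans
        (h4.symm.trans (congrArg ((conormalMap k).app ((k ≫ f) ⁻¹ᵁ U)) h2).symm)))
end

/-- Coherent locally free sheaves: sheaves of modules that are locally free of finite rank. -/
def isVectorBundle (X : Scheme.{0}) : ObjectProperty X.Modules := fun M =>
  ∀ x : X, ∃ U : X.Opens, x ∈ U ∧ ∃ r : ℕ,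
    Nonempty (M.restrict U.ι ≅
      (SheafOfModules.free (R := U.toScheme.ringCatSheaf) (Fin r) : U.toScheme.Modules))

lemma isZero_free (X : Scheme.{0}) :
    IsZero (C := X.Modules) (SheafOfModules.free (R := X.ringCatSheaf) (Fin 0)) := by
  refine (IsZero.iff_id_eq_zero (C := X.Modules) _).2 ?_
  exact Cofan.IsColimit.hom_ext (SheafOfModules.isColimitFreeCofan (Fin 0)) _ _ (fun i => i.elim0)

instance instContainsZero (X : Scheme.{0}) : (isVectorBundle X).ContainsZero where
  exists_zero := ⟨0, isZero_zero _, fun _ => ⟨⊤, trivial, 0,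
    ⟨IsZero.iso (Functor.map_isZero (restrictFunctor (⊤ : X.Opens).ι) (isZero_zero X.Modules))
      (isZero_free _)⟩⟩⟩

/-- The category of locally free sheaves of finite rank on `X`. -/
abbrev VectorBundle (X : Scheme.{0}) := (isVectorBundle X).FullSubcategory

/-- Bounded complexes of locally free sheaves of finite rank. -/
def isBounded (X : Scheme.{0}) : ObjectProperty (CochainComplex (VectorBundle X) ℤ) := fun K =>
  ∃ a b : ℤ, ∀ n, n < a ∨ b < n → IsZero (K.X n)

/-- The category of bounded complexes of locally free sheaves of finite rank on `X`. -/
abbrev BoundedComplex (X : Scheme.{0}) := (isBounded X).FullSubcategory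

/-- The complex of `𝒪_X`-modules that underlies a complex of locally free sheaves. -/
def underlyingComplex (X : Scheme.{0}) : BoundedComplex X ⥤ CochainComplex X.Modules ℤ :=
  (isBounded X).ι ⋙ (isVectorBundle X).ι.mapHomologicalComplex _

/-- Morphisms that are quasi-isomorphisms of complexes of `𝒪_X`-modules. -/
def quasiIso (X : Scheme.{0}) : MorphismProperty (BoundedComplex X) :=
  (HomologicalComplex.quasiIso X.Modules (.up ℤ)).inverseImage (underlyingComplex X)

/-- The (bounded) derived category of locally free sheaves of finite rank on `X`: bounded complexes
of such sheaves, localized at the quasi-isomorphisms.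
(For bounded complexes of such sheaves, being exact as a complex of `𝒪_X`-modules is the same as
being acyclic in the exact category of locally free sheaves.) -/
abbrev DerivedCat (X : Scheme.{0}) := (quasiIso X).Localization

section
variable {X Y Z : Scheme.{0}}

/-- `I/I²` and `Ω_{Y/ℤ}|_X` are locally free of finite rank. -/
structure HasLocallyFreeTerms (k : X ⟶ Y) : Prop where
  conormal : isVectorBundle X (conormal k)
  differentials : isVectorBundle X (restrictedDifferentials k)

lemma rel_neg_one_zero : (ComplexShape.up ℤ).Rel (-1) 0 := by simp

/-- The two-term complex `I/I² ⟶ Ω_{Y/ℤ}|_X` of locally free sheaves, with `Ω_{Y/ℤ}|_X` in degree `0`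
and `I/I²` in cohomological degree `-1` (homological degree `1`). -/
def cotangentComplex (k : X ⟶ Y) (hk : HasLocallyFreeTerms k) : BoundedComplex X where
  obj := HomologicalComplex.double (C := VectorBundle X)
    (X₀ := ⟨conormal k, hk.conormal⟩) (X₁ := ⟨restrictedDifferentials k, hk.differentials⟩)
    (ObjectProperty.homMk (conormalMap k)) rel_neg_one_zero
  property := ⟨-1, 0, fun n hn => HomologicalComplex.isZero_double_X _ _ _ (by omega) (by omega)⟩

/-- The morphism of complexes from the complex of `k ≫ f` to the complex of `k`, induced by `f`. -/
def transitionAux (k : X ⟶ Y) (f : Y ⟶ Z) (hk : HasLocallyFreeTerms k)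
    (hkf : HasLocallyFreeTerms (k ≫ f)) :
    cotangentComplex (k ≫ f) hkf ⟶ cotangentComplex k hk :=
  ObjectProperty.homMk <| HomologicalComplex.mkHomFromDouble rel_neg_one_zero (by decide)
    (ObjectProperty.homMk (conormalTransition k f) ≫
      (HomologicalComplex.doubleXIso₀ _ rel_neg_one_zero).inv)
    (ObjectProperty.homMk (restrictedDifferentialsTransition k f) ≫
      (HomologicalComplex.doubleXIso₁ _ rel_neg_one_zero (by decide)).inv)
    (by
      dsimp only [cotangentComplex]
      rw [HomologicalComplex.double_d _ _ (by decide), Category.assoc, Iso.inv_hom_id_assoc,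
        ← Category.assoc, ← Category.assoc]
      congr 1
      ext1
      exact (conormalMap_transition k f).symm)
    (fun n _ => by
      dsimp only [cotangentComplex]
      rw [HomologicalComplex.double_d_eq_zero₀ _ _ _ _ (by decide)]
      exact comp_zero)

/-- For `k : X ⟶ Y`, `f : Y ⟶ Z` and `i = k ≫ f`, the morphism of complexes from the complex of `i` to
the complex of `k` given by `s ↦ f^# s` on `I/I²` and by `da ↦ d(f^# a)` on `Ω|_X`. -/
def transition (k : X ⟶ Y) (f : Y ⟶ Z) {i : X ⟶ Z} (h : k ≫ f = i) (hk : HasLocallyFreeTerms k)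
    (hi : HasLocallyFreeTerms i) : cotangentComplex i hi ⟶ cotangentComplex k hk := by
  subst h
  exact transitionAux k f hk hi

/-- The object of the derived category of locally free sheaves on `X` defined by the complex
`I/I² ⟶ Ω_{Y/ℤ}|_X`. -/
def cotangentObject (k : X ⟶ Y) (hk : HasLocallyFreeTerms k) : DerivedCat X :=
  (quasiIso X).Q.obj (cotangentComplex k hk)

/-- The morphism induced by `transition` in the derived category. -/
def derivedTransition (k : X ⟶ Y) (f : Y ⟶ Z) {i : X ⟶ Z} (h : k ≫ f = i)
    (hk : HasLocallyFreeTerms k) (hi : HasLocallyFreeTerms i) :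
    cotangentObject i hi ⟶ cotangentObject k hk :=
  (quasiIso X).Q.map (transition k f h hk hi)

end

/-- Regular schemes: all local rings are (Noetherian) regular local rings. -/
def IsRegularScheme (X : Scheme.{0}) : Prop :=
  ∀ x : X, IsRegularLocalRing (X.presheaf.stalk x)

/-- `X` is projective over `ℤ`: it is isomorphic to a closed subscheme of some `ℙⁿ`. -/
def IsProjectiveOverInt (X : Scheme.{0}) : Prop :=
  ∃ (n : ℕ) (i : X ⟶ projectiveSpace n), IsClosedImmersion i

end
end CotangentZ

/-!
Throughout, a morphism out of `k^* M` is tested against sheaves of modules `N` pushed forward from a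
small open set `T` of `X`. By adjunction it is a morphism `M ⟶ k_* N`, and as `k_* N` only sees an
affine open set `V` of the target, it is determined by its effect on sections over `V`. So morphisms
from `I/I² = k^* I` to `N` are the `Γ(Y, V)`-linear maps from the ideal to `Γ(N, T)`, and morphisms
from `Ω_{Y/ℤ}|_X` to `N` are the derivations of `Γ(Y, V)` with values in `Γ(N, T)`
(`exists_evalUnit_conormal_eq`, `exists_evalDifferentials_eq`).

*Local freeness.* Projective space and products of projective spaces over `ℤ` are covered by affine
spaces (`isCoveredByAffineSpaces_projectiveSpace`, `isCoveredByAffineSpaces_of_isPullback`).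
Derivations of a polynomial ring are given by arbitrary values at the variables, so `Ω|_X` is
locally free. The kernel of a surjection of regular local rings is generated by a family all of
whose relations are Koszul relations (`exists_isKoszulExact_span_eq_ker`, by induction on the
dimension, dividing by an element of the kernel outside `𝔪²`). In particular the coefficients of all
relations lie in the kernel, so the family gives a basis of `I/I²` near the point
(`isVectorBundle_conormal`).

*Independence of the embedding.* Let `P` be the product of the two projective spaces and
`k₀ = (i, j) : X ⟶ P`. The projection `p₁ : P ⟶ ℙⁿ` induces a quasi-isomorphism from the complex of
`i` to the complex of `k₀` (`quasiIso_transition_of_isPullback`). Indeed, the second coordinate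
`X ⟶ ℙᵐ` extends locally to an open set of `ℙⁿ`, as the functions on a chart of `ℙᵐ` form a
polynomial ring; so `p₁` has local sections compatible with the embeddings of `X`. For such a
section, comparing linear maps on the ideals and derivations shows that the functors `Hom(-, N)`
turn the square of the two complexes into an exact sequence (`isHomExact_of_retraction`), and by
Yoneda the morphism of complexes is locally a homotopy equivalence (`exists_homotopy_inverse`,
`quasiIso_of_isHomExact`). The same holds for `p₂`, and `e = p₁^* ≫ (p₂^*)⁻¹` is an isomorphism in
the derived category. For `k : X ⟶ Y`, `f` and `g` as in the statement, `f` and `g` factor through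
`(f, g) : Y ⟶ P`, so the compatibility `e ≫ g^* = f^*` follows from functoriality
(`transition_comp`). The case `Y = P` forces the choice of `e`.
-/

namespace CotangentZ

open ZeroObject Scheme.Modules

noncomputable section

open TopologicalSpace Opposite

/-! ### Sections of sheaves supported on an affine open set -/

/-- An abelian presheaf is supported on an open set `V` when its sections over any open set `W`
are the same as its sections over `W ⊓ V`. -/
def SupportedOn {Y : Scheme.{0}} (H : TopCat.Presheaf Ab.{0} Y) (V : Y.Opens) : Prop :=
  ∀ W : Y.Opens, Function.Bijective (H.map (homOfLE (inf_le_left : W ⊓ V ≤ W)).op)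

section Gluing
variable {Y : Scheme.{0}} {V : Y.Opens} {H : TopCat.Presheaf Ab.{0} Y}

lemma map_map_apply (H : TopCat.Presheaf Ab.{0} Y) {U₁ U₂ U₃ : Y.Opens} (h₁ : U₂ ≤ U₁)
    (h₂ : U₃ ≤ U₂) (s : H.obj (op U₁)) :
    H.map (homOfLE h₂).op (H.map (homOfLE h₁).op s) = H.map (homOfLE (h₂.trans h₁)).op s := by
  rw [← ConcreteCategory.comp_apply, ← H.map_comp]; rfl

lemma map_self_apply (H : TopCat.Presheaf Ab.{0} Y) {U : Y.Opens} (h : U ≤ U)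
    (s : H.obj (op U)) : H.map (homOfLE h).op s = s := by
  have : (homOfLE h).op = 𝟙 (op U) := rfl
  rw [this, H.map_id]; rfl

/-- Inside an affine open set `V`, an open set is covered by the basic open subsets of `V` it
contains, which form a system closed under intersection. -/
lemma inf_le_iSup_basicOpen (hV : IsAffineOpen V) (W : Y.Opens) :
    W ⊓ V ≤ ⨆ f : {f : Γ(Y, V) // Y.basicOpen f ≤ W}, Y.basicOpen f.1 := by
  intro x hx
  obtain ⟨f, hf, hxf⟩ := hV.exists_basicOpen_le (V := W) ⟨x, hx.1⟩ hx.2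
  exact Opens.mem_iSup.2 ⟨⟨f, hf⟩, hxf⟩

/-- Sections of a sheaf supported on an affine open set `V` are determined by their restrictions
to the basic open subsets of `V`. -/
lemma SupportedOn.eq_of_basicOpen (hs : SupportedOn H V) (hH : H.IsSheaf) (hV : IsAffineOpen V)
    {W : Y.Opens} (s t : H.obj (op W))
    (h : ∀ (f : Γ(Y, V)) (hf : Y.basicOpen f ≤ W),
      H.map (homOfLE hf).op s = H.map (homOfLE hf).op t) : s = t := by
  apply (hs W).1
  refine TopCat.Sheaf.eq_of_locally_eq' ⟨H, hH⟩
    (fun f : {f : Γ(Y, V) // Y.basicOpen f ≤ W} => Y.basicOpen f.1) _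
    (fun f => homOfLE (le_inf f.2 (Y.basicOpen_le _))) (inf_le_iSup_basicOpen hV W) _ _ ?_
  intro f
  have := h f.1 f.2
  simpa only [map_map_apply] using this

/-- Compatible sections over the basic open subsets of `V` inside `W` glue to a section over `W`. -/
lemma SupportedOn.exists_gluing (hs : SupportedOn H V) (hH : H.IsSheaf) (hV : IsAffineOpen V)
    (W : Y.Opens) (σ : ∀ f : {f : Γ(Y, V) // Y.basicOpen f ≤ W}, H.obj (op (Y.basicOpen f.1)))
    (hσ : ∀ f g : {f : Γ(Y, V) // Y.basicOpen f ≤ W}, ∀ h : Y.basicOpen g.1 ≤ Y.basicOpen f.1,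
      H.map (homOfLE h).op (σ f) = σ g) :
    ∃ s : H.obj (op W), ∀ f, H.map (homOfLE f.2).op s = σ f := by
  obtain ⟨t, ht, -⟩ := TopCat.Sheaf.existsUnique_gluing' ⟨H, hH⟩
    (fun f : {f : Γ(Y, V) // Y.basicOpen f ≤ W} => Y.basicOpen f.1) (W ⊓ V)
    (fun f => homOfLE (le_inf f.2 (Y.basicOpen_le _))) (inf_le_iSup_basicOpen hV W) σ
    (by
      intro f g
      have e : Y.basicOpen (f.1 * g.1) = Y.basicOpen f.1 ⊓ Y.basicOpen g.1 := Y.basicOpen_mul _ _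
      have h1 : Y.basicOpen (f.1 * g.1) ≤ Y.basicOpen f.1 := e.trans_le inf_le_left
      have h2 : Y.basicOpen (f.1 * g.1) ≤ Y.basicOpen g.1 := e.trans_le inf_le_right
      have key := (hσ f ⟨f.1 * g.1, h1.trans f.2⟩ h1).trans
        (hσ g ⟨f.1 * g.1, h1.trans f.2⟩ h2).symm
      have key' := congrArg (H.map (homOfLE e.ge).op) key
      simp only [map_map_apply] at key'
      exact key')
  obtain ⟨s, rfl⟩ := (hs W).2 t
  refine ⟨s, fun f => ?_⟩
  rw [← ht f]
  exact (map_map_apply H _ _ _).symm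

/-- Compatible additive maps on the basic open subsets of an affine open set `V` extend to a
morphism of presheaves, if the target is a sheaf supported on `V`. -/
lemma SupportedOn.exists_extension (hs : SupportedOn H V) (hH : H.IsSheaf) (hV : IsAffineOpen V)
    (F : TopCat.Presheaf Ab.{0} Y)
    (φ : ∀ f : Γ(Y, V), F.obj (op (Y.basicOpen f)) →+ H.obj (op (Y.basicOpen f)))
    (hφ : ∀ (f g : Γ(Y, V)) (h : Y.basicOpen g ≤ Y.basicOpen f) (s),
      φ g (F.map (homOfLE h).op s) = H.map (homOfLE h).op (φ f s)) :
    ∃ Φ : ∀ W : Y.Opens, F.obj (op W) →+ H.obj (op W),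
      (∀ (W W' : Y.Opens) (h : W' ≤ W) (s),
        Φ W' (F.map (homOfLE h).op s) = H.map (homOfLE h).op (Φ W s)) ∧
      ∀ f, Φ (Y.basicOpen f) = φ f := by
  choose Ψ hΨ using fun (W : Y.Opens) (s : F.obj (op W)) =>
    hs.exists_gluing hH hV W (fun f => φ f.1 (F.map (homOfLE f.2).op s)) (fun f g h => by
      rw [← hφ, map_map_apply])
  refine ⟨fun W => AddMonoidHom.mk' (Ψ W) fun s t => ?_, fun W W' h s => ?_, fun f => ?_⟩
  · apply hs.eq_of_basicOpen hH hV
    intro f hf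
    simp only [map_add, hΨ _ _ ⟨f, hf⟩]
  · apply hs.eq_of_basicOpen hH hV
    intro f hf
    simp only [AddMonoidHom.mk'_apply, hΨ _ _ ⟨f, hf⟩, map_map_apply]
    exact (hΨ W s ⟨f, hf.trans h⟩).symm
  · ext s
    have := hΨ _ s ⟨f, le_rfl⟩
    rw [map_self_apply, map_self_apply] at this
    exact this
end Gluing

lemma presheaf_map_map_apply {Y : Scheme.{0}} {U₁ U₂ U₃ : Y.Opens} (h₁ : U₂ ≤ U₁)
    (h₂ : U₃ ≤ U₂) (s : Γ(Y, U₁)) :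
    Y.presheaf.map (homOfLE h₂).op (Y.presheaf.map (homOfLE h₁).op s) =
      Y.presheaf.map (homOfLE (h₂.trans h₁)).op s := by
  rw [← ConcreteCategory.comp_apply, ← Y.presheaf.map_comp]; rfl

/-! ### Morphisms given by linear maps on an affine open set -/

section Linear
variable {Y : Scheme.{0}} {V : Y.Opens}

lemma isUnit_map_basicOpen (f : Γ(Y, V)) :
    IsUnit (Y.presheaf.map (homOfLE (Y.basicOpen_le f)).op f) :=
  RingedSpace.isUnit_res_basicOpen _ f

/-- The restriction maps of `M` from the affine open set `V` to its basic open subsets are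
localizations. -/
structure IsLocalizingOn (M : Y.Modules) (V : Y.Opens) : Prop where
  surj (f : Γ(Y, V)) (s : Γ(M, Y.basicOpen f)) : ∃ (n : ℕ) (t : Γ(M, V)),
    Y.presheaf.map (homOfLE (Y.basicOpen_le f)).op f ^ n • s =
      M.presheaf.map (homOfLE (Y.basicOpen_le f)).op t
  inj (f : Γ(Y, V)) (t : Γ(M, V)) :
    M.presheaf.map (homOfLE (Y.basicOpen_le f)).op t = 0 → ∃ n : ℕ, f ^ n • t = 0

variable {M G : Y.Modules}

/-- A morphism from `M` to a module supported on `V` is determined by its values on sections over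
`V`: a section over a basic open subset comes from `V` after multiplication by a unit. -/
lemma hom_ext_of_supportedOn (hV : IsAffineOpen V) (hM : IsLocalizingOn M V)
    (hG : SupportedOn G.presheaf V) {β γ : M ⟶ G} (h : ∀ s, β.app V s = γ.app V s) : β = γ := by
  ext W s
  apply hG.eq_of_basicOpen G.isSheaf hV
  intro f hf
  erw [← app_map β (homOfLE hf) s, ← app_map γ (homOfLE hf) s]
  generalize M.presheaf.map (homOfLE hf).op s = s'
  obtain ⟨n, t, ht⟩ := hM.surj f s'
  apply ((isUnit_map_basicOpen f).pow n).smul_left_cancel.1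
  erw [← Hom.app_smul, ← Hom.app_smul]
  rw [ht, app_map, app_map, h]

/-- A linear map `h` on the sections over `V` has a value at each section `s` over a basic open set:
the element `z = f⁻ⁿ h(t)` does not depend on the presentation `f ^ n • s = t`. -/
lemma exists_localized_map (hM : IsLocalizingOn M V) (h : Γ(M, V) →ₗ[Γ(Y, V)] Γ(G, V))
    (f : Γ(Y, V)) (s : Γ(M, Y.basicOpen f)) : ∃ z : Γ(G, Y.basicOpen f),
      ∀ (n : ℕ) (t : Γ(M, V)), Y.presheaf.map (homOfLE (Y.basicOpen_le f)).op f ^ n • s =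
        M.presheaf.map (homOfLE (Y.basicOpen_le f)).op t →
      Y.presheaf.map (homOfLE (Y.basicOpen_le f)).op f ^ n • z =
        G.presheaf.map (homOfLE (Y.basicOpen_le f)).op (h t) := by
  obtain ⟨n, t, ht⟩ := hM.surj f s
  set u := Y.presheaf.map (homOfLE (Y.basicOpen_le f)).op f with hu
  have hunit := isUnit_map_basicOpen f
  obtain ⟨v, hv⟩ := hunit.pow n
  refine ⟨(↑v⁻¹ : Γ(Y, Y.basicOpen f)) • G.presheaf.map (homOfLE (Y.basicOpen_le f)).op (h t),
    fun n' t' ht' => ?_⟩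
  have h0 : M.presheaf.map (homOfLE (Y.basicOpen_le f)).op (f ^ n' • t - f ^ n • t') = 0 := by
    rw [map_sub, Scheme.Modules.map_smul, Scheme.Modules.map_smul, map_pow, map_pow, ← ht,
      ← ht', ← hu, smul_smul, smul_smul, mul_comm, sub_self]
  obtain ⟨m, hm⟩ := hM.inj f _ h0
  have h1 : f ^ m • (f ^ n' • h t - f ^ n • h t') = 0 := by
    rw [← _root_.map_smul, ← _root_.map_smul, ← map_sub, ← _root_.map_smul, hm, map_zero]
  have h2 := congrArg (G.presheaf.map (homOfLE (Y.basicOpen_le f)).op) h1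
  rw [Scheme.Modules.map_smul, map_zero, map_pow, ← hu, (hunit.pow m).smul_eq_zero, map_sub,
    Scheme.Modules.map_smul, Scheme.Modules.map_smul, map_pow, map_pow, ← hu, sub_eq_zero] at h2
  apply (hunit.pow n).smul_left_cancel.1
  rw [← h2, ← hu, ← hv, smul_comm, ← mul_smul (v : Γ(Y, Y.basicOpen f)), Units.mul_inv, one_smul]

/-- Linear maps on the sections over `V` extend to morphisms of sheaves of modules. -/
lemma exists_hom_of_linearMap (hV : IsAffineOpen V) (hM : IsLocalizingOn M V)
    (hG : SupportedOn G.presheaf V) (h : Γ(M, V) →ₗ[Γ(Y, V)] Γ(G, V)) :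
    ∃ β : M ⟶ G, ∀ s, β.app V s = h s := by
  choose ψ hψ using exists_localized_map hM h
  have uniq (f : Γ(Y, V)) (s) (z) (n : ℕ) (t : Γ(M, V))
      (h1 : Y.presheaf.map (homOfLE (Y.basicOpen_le f)).op f ^ n • s =
        M.presheaf.map (homOfLE (Y.basicOpen_le f)).op t)
      (h2 : Y.presheaf.map (homOfLE (Y.basicOpen_le f)).op f ^ n • z =
        G.presheaf.map (homOfLE (Y.basicOpen_le f)).op (h t)) : ψ f s = z := by
    apply ((isUnit_map_basicOpen f).pow n).smul_left_cancel.1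
    rw [h2, hψ f s n t h1]
  have hψadd (f : Γ(Y, V)) (s s') : ψ f (s + s') = ψ f s + ψ f s' := by
    obtain ⟨n, t, ht⟩ := hM.surj f s
    obtain ⟨n', t', ht'⟩ := hM.surj f s'
    refine uniq f _ _ (n + n') (f ^ n' • t + f ^ n • t') ?_ ?_
    · simp only [pow_add, smul_add, map_add, Scheme.Modules.map_smul, map_pow, ← ht, ← ht',
        smul_smul, mul_comm]
    · simp only [pow_add, smul_add, map_add, _root_.map_smul, Scheme.Modules.map_smul, map_pow,
        ← hψ f s n t ht, ← hψ f s' n' t' ht', smul_smul, mul_comm]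
  have hψsmul (f : Γ(Y, V)) (r : Γ(Y, V)) (s) :
      ψ f (Y.presheaf.map (homOfLE (Y.basicOpen_le f)).op r • s) =
        Y.presheaf.map (homOfLE (Y.basicOpen_le f)).op r • ψ f s := by
    obtain ⟨n, t, ht⟩ := hM.surj f s
    refine uniq f _ _ n (r • t) ?_ ?_
    · rw [smul_comm, ht, Scheme.Modules.map_smul]
    · rw [smul_comm, hψ f s n t ht, _root_.map_smul, Scheme.Modules.map_smul]
  obtain ⟨Φ, hnat, hΦ⟩ := hG.exists_extension G.isSheaf hV M.presheaf
    (fun f => AddMonoidHom.mk' (ψ f) (hψadd f)) (fun f g hfg s => by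
      obtain ⟨n, t, ht⟩ := hM.surj f s
      have hu : IsUnit (Y.presheaf.map (homOfLE hfg).op
          (Y.presheaf.map (homOfLE (Y.basicOpen_le f)).op f)) := (isUnit_map_basicOpen f).map _
      have e1 := congrArg (M.presheaf.map (homOfLE hfg).op) ht
      have e2 := congrArg (G.presheaf.map (homOfLE hfg).op) (hψ f s n t ht)
      rw [Scheme.Modules.map_smul, map_pow, map_map_apply] at e1 e2
      apply (hu.pow n).smul_left_cancel.1
      simp only [AddMonoidHom.mk'_apply]
      rw [e2, presheaf_map_map_apply, ← map_pow, ← hψsmul, map_pow,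
        ← presheaf_map_map_apply (Y.basicOpen_le f) hfg, e1]
      have := uniq g (M.presheaf.map (homOfLE (Y.basicOpen_le g)).op t)
        (G.presheaf.map (homOfLE (Y.basicOpen_le g)).op (h t)) 0 t (by simp) (by simp)
      exact this)
  have hsmul (W : Y.Opens) (r : Γ(Y, W)) (s : Γ(M, W)) : Φ W (r • s) = r • Φ W s := by
    apply hG.eq_of_basicOpen G.isSheaf hV
    intro f hf
    rw [← hnat, Scheme.Modules.map_smul, Scheme.Modules.map_smul, ← hnat, hΦ]
    simp only [AddMonoidHom.mk'_apply]
    generalize M.presheaf.map (homOfLE hf).op s = s'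
    generalize Y.presheaf.map (homOfLE hf).op r = r'
    have := hV.isLocalization_basicOpen f
    obtain ⟨n, a, ha⟩ := IsLocalization.Away.surj f r'
    rw [RingHom.algebraMap_toAlgebra] at ha
    change r' * (Y.presheaf.map (homOfLE (Y.basicOpen_le f)).op f) ^ n =
      Y.presheaf.map (homOfLE (Y.basicOpen_le f)).op a at ha
    apply ((isUnit_map_basicOpen f).pow n).smul_left_cancel.1
    rw [← map_pow, ← hψsmul, map_pow, smul_smul, smul_smul, mul_comm, ha, hψsmul]
  refine ⟨modHom Φ hsmul (fun U W i s => hnat U W i.le s), fun s => ?_⟩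
  change Φ V s = h s
  have e : Y.basicOpen (1 : Γ(Y, V)) = V := Y.basicOpen_of_isUnit isUnit_one
  have h1 := hnat V _ (Y.basicOpen_le (1 : Γ(Y, V))) s
  rw [hΦ] at h1
  simp only [AddMonoidHom.mk'_apply] at h1
  rw [uniq 1 _ (G.presheaf.map (homOfLE (Y.basicOpen_le 1)).op (h s)) 0 s (by simp) (by simp)] at h1
  have h2 := congrArg (G.presheaf.map (homOfLE e.ge).op) h1
  rw [map_map_apply, map_map_apply, map_self_apply, map_self_apply] at h2
  exact h2.symm

end Linear

/-! ### Morphisms out of the differentials, and the ideal sheaf -/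

section Derivations
variable {Y : Scheme.{0}} {V : Y.Opens} {G : Y.Modules}

/-- `Ω_{Y/ℤ}` is generated by differentials of functions, as far as morphisms are concerned. -/
lemma differentials_hom_ext {β γ : differentials Y ⟶ G}
    (h : ∀ (W : Y.Opens) (a : Γ(Y, W)), β.app W (sectionsD Y W a) = γ.app W (sectionsD Y W a)) :
    β = γ := by
  apply ((PresheafOfModules.sheafificationAdjunction (𝟙 Y.ringCatSheaf.obj)).homEquiv
    (presheafDifferentials Y) G).injective
  apply (PresheafOfModules.DifferentialsConstruction.isUniversal' (fromInt Y)).postcomp_injective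
  ext W a
  exact h W.unop a

/-- An additive map from a ring to a module that satisfies the Leibniz rule extends along a
localization at one element to a module on which that element is invertible: the derivation is
seen as a ring homomorphism to a square-zero extension. -/
lemma exists_derivation_localization {A B N : Type*} [CommRing A] [CommRing B] [Algebra A B]
    (f : A) [IsLocalization.Away f B] [AddCommGroup N] [Module B N] (D : A →+ N)
    (hD : ∀ a b, D (a * b) = algebraMap A B a • D b + algebraMap A B b • D a) :
    ∃ D' : B →+ N, (∀ a b, D' (a * b) = a • D' b + b • D' a) ∧
      ∀ a, D' (algebraMap A B a) = D a := by
  let _ : Module Bᵐᵒᵖ N := Module.compHom N ((RingHom.id B).fromOpposite mul_comm)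
  have : IsCentralScalar B N := ⟨fun _ _ => rfl⟩
  have hD1 : D 1 = 0 := by simpa using hD 1 1
  let ψ : A →+* TrivSqZeroExt B N :=
    { toFun := fun a => TrivSqZeroExt.inl (algebraMap A B a) + TrivSqZeroExt.inr (D a)
      map_one' := by simp [hD1]
      map_zero' := by simp
      map_add' := fun a b => by ext <;> simp
      map_mul' := fun a b => by ext <;> simp [hD] }
  have hu : IsUnit (ψ f) := by
    rw [TrivSqZeroExt.isUnit_iff_isUnit_fst]
    simpa [ψ] using IsLocalization.Away.algebraMap_isUnit (S := B) f
  let ψ' : B →+* TrivSqZeroExt B N := IsLocalization.Away.lift f hu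
  have hψ' (a : A) : ψ' (algebraMap A B a) = ψ a := IsLocalization.Away.lift_eq f hu a
  have hfst : (TrivSqZeroExt.fstHom B B N).toRingHom.comp ψ' = RingHom.id B := by
    apply IsLocalization.ringHom_ext (Submonoid.powers f)
    ext a
    change TrivSqZeroExt.fst (ψ' (algebraMap A B a)) = algebraMap A B a
    rw [hψ']; simp [ψ]
  have hfst' (b : B) : TrivSqZeroExt.fst (ψ' b) = b := congrArg (fun φ : B →+* B => φ b) hfst
  refine ⟨AddMonoidHom.mk' (fun b => TrivSqZeroExt.snd (ψ' b)) (by simp), fun a b => ?_,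
    fun a => ?_⟩
  · simp [hfst']
  · simp [hψ', ψ]

/-- Derivations of a localization are determined by their values on the original ring, by the
quotient rule. -/
lemma derivation_ext_localization {A B N : Type*} [CommRing A] [CommRing B] [Algebra A B]
    (f : A) [IsLocalization.Away f B] [AddCommGroup N] [Module B N] (D D' : B →+ N)
    (hD : ∀ a b, D (a * b) = a • D b + b • D a) (hD' : ∀ a b, D' (a * b) = a • D' b + b • D' a)
    (h : ∀ a, D (algebraMap A B a) = D' (algebraMap A B a)) : D = D' := by
  ext b
  obtain ⟨n, a, ha⟩ := IsLocalization.Away.surj f b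
  have e := congrArg (fun x => D x - D' x) ha
  simp only [hD, hD', h, ← map_pow, sub_self] at e
  rw [add_sub_add_left_eq_sub, ← smul_sub, map_pow, IsUnit.smul_eq_zero, sub_eq_zero] at e
  · exact e
  · exact (IsLocalization.Away.algebraMap_isUnit f).pow n

/-- A morphism from `Ω_{Y/ℤ}` to a module supported on an affine open set `V` is determined by the
derivation of `Γ(Y, V)` that it gives. -/
lemma differentials_hom_ext_of_supportedOn (hV : IsAffineOpen V) (hG : SupportedOn G.presheaf V)
    {β γ : differentials Y ⟶ G}
    (h : ∀ a : Γ(Y, V), β.app V (sectionsD Y V a) = γ.app V (sectionsD Y V a)) : β = γ := by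
  apply differentials_hom_ext
  intro W a
  apply hG.eq_of_basicOpen G.isSheaf hV
  intro f hf
  rw [← app_map β (homOfLE hf), ← app_map γ (homOfLE hf), ← sectionsD_map]
  generalize Y.presheaf.map (homOfLE hf).op a = a'
  have := hV.isLocalization_basicOpen f
  refine DFunLike.congr_fun (derivation_ext_localization f
    ((β.app _).hom.comp (sectionsD Y (Y.basicOpen f)))
    ((γ.app _).hom.comp (sectionsD Y (Y.basicOpen f))) (fun a b => ?_) (fun a b => ?_)
    fun a => ?_) a'
  · simp [sectionsD_mul]
  · simp [sectionsD_mul]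
  · rw [RingHom.algebraMap_toAlgebra]
    change β.app _ (sectionsD Y _ (Y.presheaf.map (homOfLE (Y.basicOpen_le f)).op a)) =
      γ.app _ (sectionsD Y _ (Y.presheaf.map (homOfLE (Y.basicOpen_le f)).op a))
    rw [sectionsD_map, app_map, app_map, h]

/-- A derivation of the ring of functions on an affine open set `V` with values in the sections
over `V` of a module supported on `V` comes from a morphism out of the sheaf of differentials. -/
lemma exists_differentials_hom (hV : IsAffineOpen V) (hG : SupportedOn G.presheaf V)
    (D : Γ(Y, V) →+ Γ(G, V)) (hD : ∀ a b, D (a * b) = a • D b + b • D a) :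
    ∃ β : differentials Y ⟶ G, ∀ a, β.app V (sectionsD Y V a) = D a := by
  have key (f : Γ(Y, V)) : ∃ D' : Γ(Y, Y.basicOpen f) →+ Γ(G, Y.basicOpen f),
      (∀ a b, D' (a * b) = a • D' b + b • D' a) ∧
      ∀ a, D' (Y.presheaf.map (homOfLE (Y.basicOpen_le f)).op a) =
        G.presheaf.map (homOfLE (Y.basicOpen_le f)).op (D a) := by
    have := hV.isLocalization_basicOpen f
    refine exists_derivation_localization f
      ((G.presheaf.map (homOfLE (Y.basicOpen_le f)).op).hom.comp D) fun a b => ?_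
    change G.presheaf.map (homOfLE (Y.basicOpen_le f)).op (D (a * b)) = _
    rw [hD, map_add, Scheme.Modules.map_smul, Scheme.Modules.map_smul]
    rfl
  choose δ hmul hδ using key
  obtain ⟨Φ, hnat, hΦ⟩ := hG.exists_extension G.isSheaf hV
    (Y.presheaf ⋙ forget₂ CommRingCat RingCat ⋙ forget₂ RingCat Ab) δ (fun f g hfg s => by
      have hres : ∀ a b, Y.presheaf.map (homOfLE hfg).op (a * b) =
        Y.presheaf.map (homOfLE hfg).op a * Y.presheaf.map (homOfLE hfg).op b := map_mul _
      change δ g (Y.presheaf.map (homOfLE hfg).op s) = _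
      have hg := hV.isLocalization_basicOpen f
      let _ : Module Γ(Y, Y.basicOpen f) Γ(G, Y.basicOpen g) :=
        Module.compHom _ (Y.presheaf.map (homOfLE hfg).op).hom
      refine DFunLike.congr_fun (derivation_ext_localization f (N := Γ(G, Y.basicOpen g))
        ((δ g).comp (Y.presheaf.map (homOfLE hfg).op).hom.toAddMonoidHom)
        ((G.presheaf.map (homOfLE hfg).op).hom.comp (δ f)) (fun a b => ?_) (fun a b => ?_)
        (fun a => ?_)) s
      · change δ g (Y.presheaf.map (homOfLE hfg).op (a * b)) = _
        rw [hres, hmul]; rfl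
      · change G.presheaf.map (homOfLE hfg).op (δ f (a * b)) = _
        rw [hmul, map_add, Scheme.Modules.map_smul, Scheme.Modules.map_smul]; rfl
      · change δ g (Y.presheaf.map (homOfLE hfg).op
          (Y.presheaf.map (homOfLE (Y.basicOpen_le f)).op a)) =
          G.presheaf.map (homOfLE hfg).op (δ f (Y.presheaf.map (homOfLE (Y.basicOpen_le f)).op a))
        rw [presheaf_map_map_apply, hδ, hδ, map_map_apply])
  have hnat' (W W' : Y.Opens) (h : W' ≤ W) (s : Γ(Y, W)) :
      Φ W' (Y.presheaf.map (homOfLE h).op s) = G.presheaf.map (homOfLE h).op (Φ W s) :=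
    hnat W W' h s
  refine ⟨descDifferentials G (fun U => Φ U) (fun U a b => ?_) (fun U W i a => hnat U W i.le a),
    fun a => ?_⟩
  · apply hG.eq_of_basicOpen G.isSheaf hV
    intro f hf
    rw [← hnat', map_add, Scheme.Modules.map_smul, Scheme.Modules.map_smul, ← hnat', ← hnat', hΦ,
      map_mul, hmul]
  · refine (descDifferentials_sectionsD _ _ _ _ _ _).trans ?_
    have e : Y.basicOpen (1 : Γ(Y, V)) = V := Y.basicOpen_of_isUnit isUnit_one
    have h1 := hnat' V _ (Y.basicOpen_le (1 : Γ(Y, V))) a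
    rw [hΦ, hδ] at h1
    have h2 := congrArg (G.presheaf.map (homOfLE e.ge).op) h1
    rw [map_map_apply, map_map_apply, map_self_apply, map_self_apply] at h2
    exact h2.symm

end Derivations

section Ideal
variable {X Y : Scheme.{0}} (k : X ⟶ Y)

lemma preservesLimits_sections (U : Y.Opens) : PreservesLimits
    (toPresheaf Y ⋙ (evaluation (Opens Y)ᵒᵖ Ab.{0}).obj (op U)) := by
  have : PreservesLimits ((evaluation (Opens Y)ᵒᵖ Ab.{0}).obj (op U)) := inferInstance
  exact comp_preservesLimits _ _

lemma idealIncl_injective (U : Y.Opens) : Function.Injective (idealIncl k U) := by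
  have := preservesLimits_sections U
  have h1 : Mono ((toPresheaf Y ⋙ (evaluation (Opens Y)ᵒᵖ Ab.{0}).obj (op U)).map
      (kernel.ι (structureMap k))) := inferInstance
  exact (AddCommGrpCat.mono_iff_injective _).1 h1

lemma exists_idealIncl_eq {U : Y.Opens} (a : Γ(Y, U)) (ha : k.app U a = 0) :
    ∃ s, idealIncl k U s = a := by
  let F := toPresheaf Y ⋙ (evaluation (Opens Y)ᵒᵖ Ab.{0}).obj (op U)
  have : PreservesLimits F := preservesLimits_sections U
  let S : ShortComplex Y.Modules := ShortComplex.mk (kernel.ι (structureMap k)) (structureMap k)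
    (kernel.condition _)
  have hS : S.Exact := ShortComplex.exact_kernel _
  have : F.PreservesZeroMorphisms := ⟨fun _ _ => rfl⟩
  have h := hS.map_of_mono_of_preservesKernel F inferInstance inferInstance
  exact (ShortComplex.ab_exact_iff _).1 h a ha

/-- The ideal sheaf of an affine morphism behaves like a quasi-coherent sheaf: both `𝒪_Y` and
`k_* 𝒪_X` have localizations as restriction maps, hence so does the kernel. -/
lemma isLocalizingOn_idealModule [IsAffineHom k] {V : Y.Opens} (hV : IsAffineOpen V) :
    IsLocalizingOn (idealModule k) V where
  surj f s := by
    have := hV.isLocalization_basicOpen f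
    obtain ⟨n, a, ha⟩ := IsLocalization.Away.surj f (idealIncl k _ s)
    rw [RingHom.algebraMap_toAlgebra] at ha
    change idealIncl k _ s * (Y.presheaf.map (homOfLE (Y.basicOpen_le f)).op f) ^ n =
      Y.presheaf.map (homOfLE (Y.basicOpen_le f)).op a at ha
    have hU := hV.preimage k
    have hloc := hU.isLocalization_basicOpen (k.app V f)
    have h0 : X.presheaf.map (homOfLE (X.basicOpen_le (k.app V f))).op (k.app V a) = 0 := by
      have e : X.basicOpen (k.app V f) = k ⁻¹ᵁ Y.basicOpen f := (Scheme.preimage_basicOpen k f).symm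
      have h1 := congrArg (k.app (Y.basicOpen f)) ha
      rw [map_mul, app_idealIncl, zero_mul] at h1
      have h2 : k.app (Y.basicOpen f) (Y.presheaf.map (homOfLE (Y.basicOpen_le f)).op a) =
        X.presheaf.map (homOfLE (k.preimage_mono (Y.basicOpen_le f))).op (k.app V a) :=
        ConcreteCategory.congr_hom (k.naturality (homOfLE (Y.basicOpen_le f)).op) a
      have h3 := congrArg (X.presheaf.map (homOfLE e.le).op) (h1.trans h2)
      rw [presheaf_map_map_apply, map_zero] at h3
      exact h3.symm
    have h0' : algebraMap Γ(X, k ⁻¹ᵁ V) Γ(X, X.basicOpen (k.app V f)) (k.app V a) = 0 := h0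
    rw [IsLocalization.map_eq_zero_iff (Submonoid.powers (k.app V f))] at h0'
    obtain ⟨⟨_, m, rfl⟩, hm⟩ := h0'
    obtain ⟨t, ht⟩ := exists_idealIncl_eq k (f ^ m * a) (by
      rw [map_mul, map_pow]; exact hm)
    refine ⟨m + n, t, idealIncl_injective k _ ?_⟩
    rw [idealIncl_smul, idealIncl_map, ht, map_mul, map_pow, ← ha, pow_add]
    ring
  inj f t ht := by
    have := hV.isLocalization_basicOpen f
    have h0 := congrArg (idealIncl k _) ht
    rw [idealIncl_map, map_zero] at h0
    have h0' : algebraMap Γ(Y, V) Γ(Y, Y.basicOpen f) (idealIncl k V t) = 0 := h0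
    rw [IsLocalization.map_eq_zero_iff (Submonoid.powers f)] at h0'
    obtain ⟨⟨_, m, rfl⟩, hm⟩ := h0'
    refine ⟨m, idealIncl_injective k _ ?_⟩
    rw [idealIncl_smul, map_zero]
    exact hm

end Ideal

/-! ### Freeness by a universal property, and local detection of isomorphisms -/

section Free
variable {X : Scheme.{0}}

/-- Global sections `s` of `M` are universal if morphisms out of `M` are the same as families of
global sections, by evaluation at `s`. -/
def IsUniversalFamily {M : X.Modules} {r : ℕ} (s : Fin r → Γ(M, ⊤)) : Prop :=
  ∀ (N : X.Modules) (n : Fin r → Γ(N, ⊤)), ∃! β : M ⟶ N, ∀ j, β.app ⊤ (s j) = n j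

lemma IsUniversalFamily.nonempty_iso {M M' : X.Modules} {r : ℕ} {s : Fin r → Γ(M, ⊤)}
    {s' : Fin r → Γ(M', ⊤)} (h : IsUniversalFamily s) (h' : IsUniversalFamily s') :
    Nonempty (M ≅ M') := by
  obtain ⟨a, ha, -⟩ := h M' s'
  obtain ⟨b, hb, -⟩ := h' M s
  refine ⟨⟨a, b, ?_, ?_⟩⟩
  · exact (h M s).unique (fun j => by simp [ha, hb]) (fun j => by simp)
  · exact (h' M' s').unique (fun j => by simp [ha, hb]) (fun j => by simp)

/-- The basis of the free sheaf of modules of rank `r`. -/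
def freeBasis (X : Scheme.{0}) (r : ℕ) (j : Fin r) :
    Γ((SheafOfModules.free (R := X.ringCatSheaf) (Fin r) : X.Modules), ⊤) :=
  (SheafOfModules.freeSection (R := X.ringCatSheaf) j).1 (op ⊤)

lemma isUniversalFamily_freeBasis (X : Scheme.{0}) (r : ℕ) :
    IsUniversalFamily (M := SheafOfModules.free (R := X.ringCatSheaf) (Fin r))
      (freeBasis X r) := by
  intro N n
  let σ (m : Γ(N, ⊤)) : SheafOfModules.sections N := PresheafOfModules.sectionsMk
    (fun U => N.presheaf.map (homOfLE le_top : U.unop ⟶ ⊤).op m)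
    (fun U V f => map_map_apply N.presheaf le_top f.unop.le m)
  have hσ (m : Γ(N, ⊤)) (t : SheafOfModules.sections N) (h : t.1 (op ⊤) = m) : t = σ m := by
    apply PresheafOfModules.sections_ext
    intro U
    rw [← PresheafOfModules.sections_property t (homOfLE le_top : U.unop ⟶ ⊤).op, h]
    rfl
  have hσ' (m : Γ(N, ⊤)) : (σ m).1 (op ⊤) = m := map_self_apply N.presheaf le_rfl m
  let e := SheafOfModules.freeHomEquiv N (I := Fin r)
  have he (β : SheafOfModules.free (R := X.ringCatSheaf) (Fin r) ⟶ N) (j) :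
      (e β j).1 (op ⊤) = Hom.app (M := SheafOfModules.free (R := X.ringCatSheaf) (Fin r)) β ⊤
        (freeBasis X r j) := rfl
  refine ⟨e.symm (fun j => σ (n j)), fun j => ?_, fun β hβ => ?_⟩
  · refine (he _ j).symm.trans ?_
    rw [Equiv.apply_symm_apply]
    exact hσ' _
  · exact (Equiv.eq_symm_apply e).2 (funext fun j => hσ _ _ ((he β j).trans (hβ j)))

/-- If morphisms from `M` to modules pushed forward from the open set `T` are naturally the same as
`r`-tuples of sections over `T`, then `M` is free of rank `r` on `T`. -/
lemma nonempty_restrict_iso_free {M : X.Modules} {T : X.Opens} {r : ℕ}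
    (ev : ∀ N : T.toScheme.Modules, (M ⟶ (pushforward T.ι).obj N) → Fin r → Γ(N, ⊤))
    (hev : ∀ N, Function.Bijective (ev N))
    (nat : ∀ (N N' : T.toScheme.Modules) (ψ : N ⟶ N') (β : M ⟶ (pushforward T.ι).obj N) (j),
      ev N' (β ≫ (pushforward T.ι).map ψ) j = ψ.app ⊤ (ev N β j)) :
    Nonempty (M.restrict T.ι ≅
      (SheafOfModules.free (R := T.toScheme.ringCatSheaf) (Fin r) : T.toScheme.Modules)) := by
  let adj := restrictAdjunction T.ι
  refine IsUniversalFamily.nonempty_iso (s := ev _ (adj.unit.app M)) (fun N n => ?_)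
    (isUniversalFamily_freeBasis T.toScheme r)
  have key (β : M.restrict T.ι ⟶ N) (j) :
      β.app ⊤ (ev _ (adj.unit.app M) j) = ev N (adj.homEquiv _ _ β) j := by
    rw [Adjunction.homEquiv_unit, nat]
  obtain ⟨γ, rfl⟩ := (hev N).2 n
  refine ⟨(adj.homEquiv _ _).symm γ, fun j => ?_, fun β hβ => ?_⟩
  · simp only [key, Equiv.apply_symm_apply]
  · rw [Equiv.eq_symm_apply]
    apply (hev N).1
    ext j
    rw [← key, hβ]
end Free

section Local
variable {X : Scheme.{0}}

lemma mono_of_injective {M N : X.Modules} (φ : M ⟶ N)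
    (h : ∀ U, Function.Injective (φ.app U)) : Mono φ := by
  have : Mono ((toPresheaf X).map φ) := by
    have (U : (Opens X)ᵒᵖ) : Mono (((toPresheaf X).map φ).app U) :=
      (AddCommGrpCat.mono_iff_injective _).2 (h U.unop)
    exact NatTrans.mono_of_mono_app _
  exact (toPresheaf X).mono_of_mono_map this

lemma app_injective_of_mono {M N : X.Modules} (φ : M ⟶ N) [Mono φ] (U : X.Opens) :
    Function.Injective (φ.app U) := by
  have := preservesLimits_sections U
  have h1 : Mono ((toPresheaf X ⋙ (evaluation (Opens X)ᵒᵖ Ab.{0}).obj (op U)).map φ) :=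
    inferInstance
  exact (AddCommGrpCat.mono_iff_injective _).1 h1

instance additive_restrictFunctor {U : Scheme.{0}} (f : U ⟶ X) [IsOpenImmersion f] :
    (restrictFunctor f).Additive where
  map_add := rfl

/-- Restriction to an open subscheme is exact. -/
instance preservesHomology_restrictFunctor {U : Scheme.{0}} (f : U ⟶ X) [IsOpenImmersion f] :
    (restrictFunctor f).PreservesHomology := by
  have : ∀ (S : ShortComplex X.Modules), S.ShortExact →
      (S.map (restrictFunctor f)).ShortExact := by
    intro S hS
    have h1 : PreservesFiniteColimits (restrictFunctor f) := inferInstance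
    have t : (∀ S : ShortComplex X.Modules, S.ShortExact →
        (S.map (restrictFunctor f)).Exact ∧ Epi ((restrictFunctor f).map S.g)) ↔
        PreservesFiniteColimits (restrictFunctor f) :=
      (Functor.preservesFiniteColimits_tfae (restrictFunctor f)).out 0 3
    obtain ⟨h2, h3⟩ := t.2 h1 S hS
    have := hS.mono_f
    have h4 : Mono (S.map (restrictFunctor f)).f :=
      mono_of_injective _ fun W => app_injective_of_mono S.f (f ''ᵁ W)
    exact { exact := h2, mono_f := h4, epi_g := h3 }
  exact ((Functor.exact_tfae (restrictFunctor f)).out 0 2).1 this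

/-- Isomorphisms can be detected on an open cover. -/
lemma isIso_of_isIso_restrict {M N : X.Modules} (φ : M ⟶ N)
    (h : ∀ x : X, ∃ T : X.Opens, x ∈ T ∧ IsIso ((restrictFunctor T.ι).map φ)) : IsIso φ := by
  let B : {W : X.Opens // IsIso (φ.app W)} → X.Opens := Subtype.val
  have hB : Opens.IsBasis (Set.range B) := by
    rw [Opens.isBasis_iff_nbhd]
    intro U x hx
    obtain ⟨T, hxT, hT⟩ := h x
    refine ⟨U ⊓ T, ⟨⟨U ⊓ T, ?_⟩, rfl⟩, ⟨hx, hxT⟩, inf_le_left⟩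
    have h1 : IsIso (((restrictFunctor T.ι).map φ).app (T.ι ⁻¹ᵁ U)) := inferInstance
    have h2 : T.ι ''ᵁ (T.ι ⁻¹ᵁ U) = U ⊓ T := by
      rw [Scheme.Hom.image_preimage_eq_opensRange_inf, Scheme.Opens.opensRange_ι, inf_comm]
    have h3 : IsIso (φ.app (T.ι ''ᵁ (T.ι ⁻¹ᵁ U))) := h1
    rwa [h2] at h3
  let F : TopCat.Sheaf Ab.{0} X := ⟨M.presheaf, M.isSheaf⟩
  let G : TopCat.Sheaf Ab.{0} X := ⟨N.presheaf, N.isSheaf⟩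
  let ψ : F ⟶ G := ⟨φ.mapPresheaf⟩
  have hψ : IsIso ψ := TopCat.Sheaf.isIso_iff_isIso_basis hB (fun i => i.2)
  have h4 : IsIso ((toPresheaf X).map φ) :=
    inferInstanceAs (IsIso ((TopCat.Sheaf.forget _ _).map ψ))
  exact isIso_of_reflects_iso φ (toPresheaf X)

/-- Being a quasi-isomorphism is local, as restriction to open subschemes is exact. -/
lemma shortComplexQuasiIso_of_restrict {S S' : ShortComplex X.Modules} (φ : S ⟶ S')
    (h : ∀ x : X, ∃ T : X.Opens, x ∈ T ∧
      ShortComplex.QuasiIso ((restrictFunctor T.ι).mapShortComplex.map φ)) :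
    ShortComplex.QuasiIso φ := by
  rw [ShortComplex.quasiIso_iff]
  apply isIso_of_isIso_restrict
  intro x
  obtain ⟨T, hx, hT⟩ := h x
  refine ⟨T, hx, ?_⟩
  rw [ShortComplex.quasiIso_iff] at hT
  have := ShortComplex.mapHomologyIso_hom_naturality φ (restrictFunctor T.ι)
  have h2 : IsIso ((S.mapHomologyIso (restrictFunctor T.ι)).hom ≫
      (restrictFunctor T.ι).map (ShortComplex.homologyMap φ)) := by
    rw [← this]
    exact IsIso.comp_isIso' hT inferInstance
  exact IsIso.of_isIso_comp_left (S.mapHomologyIso (restrictFunctor T.ι)).hom _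

end Local

/-! ### Quasi-isomorphisms of two-term complexes -/

section Contraction

/-- For a commutative square `K₁ ⟶ K₀`, `L₁ ⟶ L₀`, seen as a morphism of two-term complexes: the
sequence `0 ⟶ Hom(L₀, N) ⟶ Hom(L₁, N) ⊕ Hom(K₀, N) ⟶ Hom(K₁, N) ⟶ 0` is exact, and already
`Hom(L₁, N) ⟶ Hom(K₁, N)` is surjective. -/
structure IsHomExact {C : Type*} [Category C] {K₁ K₀ L₁ L₀ : C} (dK : K₁ ⟶ K₀) (dL : L₁ ⟶ L₀)
    (a : K₁ ⟶ L₁) (b : K₀ ⟶ L₀) (N : C) : Prop where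
  inj (δ δ' : L₀ ⟶ N) : dL ≫ δ = dL ≫ δ' → b ≫ δ = b ≫ δ' → δ = δ'
  mid (h : L₁ ⟶ N) (D : K₀ ⟶ N) : a ≫ h = dK ≫ D → ∃ δ : L₀ ⟶ N, dL ≫ δ = h ∧ b ≫ δ = D
  surj (h : K₁ ⟶ N) : ∃ h' : L₁ ⟶ N, a ≫ h' = h

variable {C : Type*} [Category C] [Preadditive C] {K₁ K₀ L₁ L₀ : C} {dK : K₁ ⟶ K₀} {dL : L₁ ⟶ L₀}
    {a : K₁ ⟶ L₁} {b : K₀ ⟶ L₀}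

/-- If `Hom`-exactness holds against all objects, then the square is split by a homotopy inverse
`(r, p)` and a homotopy `t`. -/
lemma exists_homotopy_inverse (comm : a ≫ dL = dK ≫ b) (h : ∀ N, IsHomExact dK dL a b N) :
    ∃ (r : L₁ ⟶ K₁) (p : L₀ ⟶ K₀) (t : L₀ ⟶ L₁), a ≫ r = 𝟙 _ ∧ b ≫ p = 𝟙 _ ∧ dL ≫ p = r ≫ dK ∧
      dL ≫ t = 𝟙 _ - r ≫ a ∧ p ≫ b + t ≫ dL = 𝟙 _ := by
  obtain ⟨r, hr⟩ := (h K₁).surj (𝟙 _)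
  obtain ⟨p, hp, hp'⟩ := (h K₀).mid (r ≫ dK) (𝟙 _) (by simp [reassoc_of% hr])
  obtain ⟨t, ht, ht'⟩ := (h L₁).mid (𝟙 _ - r ≫ a) 0 (by simp [reassoc_of% hr])
  refine ⟨r, p, t, hr, hp', hp, ht, (h L₀).inj _ _ ?_ ?_⟩
  · simp [reassoc_of% hp, reassoc_of% ht, ← comm]
  · simp [reassoc_of% hp', reassoc_of% ht']

end Contraction

section QuasiIso
variable {X : Scheme.{0}}

/-- Two-term complexes, in degrees `-1` and `0`. -/
def IsTwoTerm {C : Type*} [Category C] [Preadditive C] (K : CochainComplex C ℤ) : Prop :=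
  ∀ n, n ≠ -1 → n ≠ 0 → IsZero (K.X n)

lemma shortComplexQuasiIso_of_homotopy {C : Type*} [Category C] [Abelian C]
    {S S' : ShortComplex C} (φ : S ⟶ S') (ψ : S' ⟶ S) (h : φ ≫ ψ = 𝟙 S)
    (h' : ShortComplex.Homotopy (ψ ≫ φ) (𝟙 S')) : ShortComplex.QuasiIso φ := by
  rw [ShortComplex.quasiIso_iff]
  refine ⟨ShortComplex.homologyMap ψ, ?_, ?_⟩
  · rw [← ShortComplex.homologyMap_comp, h, ShortComplex.homologyMap_id]
  · rw [← ShortComplex.homologyMap_comp, h'.homologyMap_congr, ShortComplex.homologyMap_id]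

/-- A morphism of two-term complexes with a homotopy inverse `(r, p)`, that is a retraction, is a
quasi-isomorphism. -/
lemma quasiIso_of_homotopy_inverse {C : Type*} [Category C] [Abelian C] {K L : CochainComplex C ℤ}
    (hK : IsTwoTerm K) (hL : IsTwoTerm L) (φ : K ⟶ L) (r : L.X (-1) ⟶ K.X (-1))
    (p : L.X 0 ⟶ K.X 0) (t : L.X 0 ⟶ L.X (-1)) (h1 : φ.f (-1) ≫ r = 𝟙 _) (h2 : φ.f 0 ≫ p = 𝟙 _)
    (h3 : L.d (-1) 0 ≫ p = r ≫ K.d (-1) 0) (h4 : L.d (-1) 0 ≫ t = 𝟙 _ - r ≫ φ.f (-1))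
    (h5 : p ≫ φ.f 0 + t ≫ L.d (-1) 0 = 𝟙 _) : QuasiIso φ := by
  rw [quasiIso_iff]
  intro n
  by_cases hn0 : n = 0
  · subst hn0
    rw [quasiIsoAt_iff' φ (-1) 0 1 (by simp) (by simp)]
    have z1 := hK 1 (by decide) (by decide)
    have z2 := hL 1 (by decide) (by decide)
    let ψ : L.sc' (-1) 0 1 ⟶ K.sc' (-1) 0 1 :=
      { τ₁ := r, τ₂ := p, τ₃ := 0, comm₁₂ := h3.symm, comm₂₃ := z1.eq_of_tgt _ _ }
    refine shortComplexQuasiIso_of_homotopy _ ψ ?_ ?_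
    · ext
      · exact h1
      · exact h2
      · exact z1.eq_of_src _ _
    · have e1 : r ≫ φ.f (-1) = L.d (-1) 0 ≫ (-t) + 0 + 𝟙 (L.X (-1)) := by
        rw [Preadditive.comp_neg, h4]; abel
      have e2 : p ≫ φ.f 0 = L.d 0 1 ≫ (0 : L.X 1 ⟶ L.X 0) + (-t) ≫ L.d (-1) 0 + 𝟙 (L.X 0) := by
        rw [← h5, comp_zero, Preadditive.neg_comp]; abel
      exact { h₀ := 0, h₁ := -t, h₂ := 0, h₃ := 0, h₀_f := zero_comp, g_h₃ := comp_zero,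
              comm₁ := e1, comm₂ := e2, comm₃ := z2.eq_of_src _ _ }
  by_cases hn1 : n = -1
  · subst hn1
    rw [quasiIsoAt_iff' φ (-2) (-1) 0 (by simp) (by simp)]
    have z1 := hK (-2) (by decide) (by decide)
    have z2 := hL (-2) (by decide) (by decide)
    let ψ : L.sc' (-2) (-1) 0 ⟶ K.sc' (-2) (-1) 0 :=
      { τ₁ := 0, τ₂ := r, τ₃ := p, comm₁₂ := z2.eq_of_src _ _, comm₂₃ := h3.symm }
    refine shortComplexQuasiIso_of_homotopy _ ψ ?_ ?_
    · ext
      · exact z1.eq_of_src _ _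
      · exact h1
      · exact h2
    · have e2 : r ≫ φ.f (-1) =
          L.d (-1) 0 ≫ (-t) + (0 : L.X (-1) ⟶ L.X (-2)) ≫ L.d (-2) (-1) + 𝟙 (L.X (-1)) := by
        rw [Preadditive.comp_neg, h4, zero_comp]; abel
      have e3 : p ≫ φ.f 0 = 0 + (-t) ≫ L.d (-1) 0 + 𝟙 (L.X 0) := by
        rw [← h5, Preadditive.neg_comp]; abel
      exact { h₀ := 0, h₁ := 0, h₂ := -t, h₃ := 0, h₀_f := zero_comp, g_h₃ := comp_zero,
              comm₁ := z2.eq_of_src _ _, comm₂ := e2, comm₃ := e3 }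
  · have a := hK n hn1 hn0
    have b := hL n hn1 hn0
    rw [quasiIsoAt_iff_isIso_homologyMap]
    have a' : IsZero (K.homology n) :=
      (ShortComplex.exact_iff_isZero_homology (K.sc n)).1 (ShortComplex.exact_of_isZero_X₂ _ a)
    have b' : IsZero (L.homology n) :=
      (ShortComplex.exact_iff_isZero_homology (L.sc n)).1 (ShortComplex.exact_of_isZero_X₂ _ b)
    exact ⟨0, a'.eq_of_src _ _, b'.eq_of_src _ _⟩

/-- `Hom`-exactness against modules pushed forward from `U` is `Hom`-exactness on `U`, by the
adjunction between restriction and pushforward. -/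
lemma isHomExact_restrict {K₁ K₀ L₁ L₀ : X.Modules} {dK : K₁ ⟶ K₀} {dL : L₁ ⟶ L₀}
    {a : K₁ ⟶ L₁} {b : K₀ ⟶ L₀} {U : Scheme.{0}} (u : U ⟶ X) [IsOpenImmersion u] (N : U.Modules)
    (h : IsHomExact dK dL a b ((pushforward u).obj N)) :
    IsHomExact ((restrictFunctor u).map dK) ((restrictFunctor u).map dL)
      ((restrictFunctor u).map a) ((restrictFunctor u).map b) N := by
  let adj := restrictAdjunction u
  have nat {A B : X.Modules} (f : A ⟶ B) (g : (restrictFunctor u).obj B ⟶ N) :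
      adj.homEquiv _ _ ((restrictFunctor u).map f ≫ g) = f ≫ adj.homEquiv _ _ g :=
    adj.homEquiv_naturality_left f g
  refine ⟨fun δ δ' h1 h2 => ?_, fun r D h1 => ?_, fun r => ?_⟩
  · apply (adj.homEquiv _ _).injective
    refine h.inj _ _ ?_ ?_
    · rw [← nat, ← nat, h1]
    · rw [← nat, ← nat, h2]
  · obtain ⟨δ, h2, h3⟩ := h.mid (adj.homEquiv _ _ r) (adj.homEquiv _ _ D) (by
      rw [← nat, ← nat, h1])
    refine ⟨(adj.homEquiv _ _).symm δ, ?_, ?_⟩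
    · apply (adj.homEquiv _ _).injective
      rw [nat, Equiv.apply_symm_apply, h2]
    · apply (adj.homEquiv _ _).injective
      rw [nat, Equiv.apply_symm_apply, h3]
  · obtain ⟨h', hh⟩ := h.surj (adj.homEquiv _ _ r)
    refine ⟨(adj.homEquiv _ _).symm h', ?_⟩
    apply (adj.homEquiv _ _).injective
    rw [nat, Equiv.apply_symm_apply, hh]

/-- A morphism of two-term complexes of sheaves of modules is a quasi-isomorphism if, locally on
`X`, the sequence of morphisms to modules pushed forward from an open set is exact. -/
lemma quasiIso_of_isHomExact {K L : CochainComplex X.Modules ℤ}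
    (hK : IsTwoTerm K) (hL : IsTwoTerm L) (φ : K ⟶ L)
    (h : ∀ x : X, ∃ T : X.Opens, x ∈ T ∧ ∀ N : T.toScheme.Modules,
      IsHomExact (K.d (-1) 0) (L.d (-1) 0) (φ.f (-1)) (φ.f 0) ((pushforward T.ι).obj N)) :
    QuasiIso φ := by
  rw [quasiIso_iff]
  intro n
  rw [quasiIsoAt_iff]
  apply shortComplexQuasiIso_of_restrict
  intro x
  obtain ⟨T, hx, hT⟩ := h x
  refine ⟨T, hx, ?_⟩
  let F := restrictFunctor T.ι
  obtain ⟨r, p, t, h1, h2, h3, h4, h5⟩ := exists_homotopy_inverse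
    (dK := F.map (K.d (-1) 0)) (dL := F.map (L.d (-1) 0)) (a := F.map (φ.f (-1)))
    (b := F.map (φ.f 0)) (by rw [← F.map_comp, ← F.map_comp, φ.comm])
    (fun N => isHomExact_restrict T.ι N (hT N))
  have key : QuasiIso ((F.mapHomologicalComplex (.up ℤ)).map φ) :=
    quasiIso_of_homotopy_inverse (fun n h h' => F.map_isZero (hK n h h'))
      (fun n h h' => F.map_isZero (hL n h h')) _ r p t h1 h2 h3 h4 h5
  exact (quasiIsoAt_iff _ n).1 (key.quasiIsoAt n)

end QuasiIso

/-! ### Evaluation of morphisms out of pullbacks -/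

section Supported
variable {X Y : Scheme.{0}} {H : TopCat.Presheaf Ab.{0} X} {T T' : X.Opens}

lemma bijective_map_of_eq (H : TopCat.Presheaf Ab.{0} X) {U U' : X.Opens} (e : U = U')
    (h : U ≤ U') : Function.Bijective (H.map (homOfLE h).op) := by
  subst e
  have h1 : (H.map (homOfLE h).op : H.obj (op U) → H.obj (op U)) = id :=
    funext fun s => map_self_apply H h s
  rw [h1]
  exact Function.bijective_id

lemma SupportedOn.bijective_of_le (hH : SupportedOn H T) (h : T ≤ T') :
    Function.Bijective (H.map (homOfLE h).op) := by
  have e : T = T' ⊓ T := (inf_eq_right.2 h).symm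
  have h1 := (bijective_map_of_eq H e e.le).comp (hH T')
  convert h1 using 1
  ext s
  exact (map_map_apply H _ _ s).symm

lemma SupportedOn.mono (hH : SupportedOn H T) (h : T ≤ T') : SupportedOn H T' := by
  intro W
  have h0 : W ⊓ T ≤ W ⊓ T' := inf_le_inf_left W h
  have h1 : Function.Bijective (H.map (homOfLE h0).op) := by
    have e : W ⊓ T = (W ⊓ T') ⊓ T := by rw [inf_assoc, inf_eq_right.2 h]
    have := (bijective_map_of_eq H e e.le).comp (hH (W ⊓ T'))
    convert this using 1
    ext s
    exact (map_map_apply H _ _ s).symm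
  refine (Function.Bijective.of_comp_iff' h1 _).1 ?_
  convert hH W using 1
  ext s
  exact map_map_apply H _ _ s

lemma SupportedOn.pushforward {N : X.Modules} (k : X ⟶ Y) {V : Y.Opens}
    (hN : SupportedOn N.presheaf (k ⁻¹ᵁ V)) :
    SupportedOn ((pushforward k).obj N).presheaf V :=
  fun W => hN (k ⁻¹ᵁ W)

/-- The modules against which local statements on `T` are tested are supported on `T`. -/
lemma supportedOn_pushforward_ι (T : X.Opens) (N : T.toScheme.Modules) :
    SupportedOn ((Scheme.Modules.pushforward T.ι).obj N).presheaf T := by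
  intro W
  have e : T.ι ⁻¹ᵁ (W ⊓ T) = T.ι ⁻¹ᵁ W := by
    rw [Scheme.Hom.preimage_inf, Scheme.Opens.ι_preimage_self, inf_top_eq]
  exact bijective_map_of_eq N.presheaf e _

end Supported

section Eval
variable {X Y : Scheme.{0}} (k : X ⟶ Y) {V : Y.Opens} {T : X.Opens} (hT : T ≤ k ⁻¹ᵁ V)
  {N N' : X.Modules}

/-- The value over `T` of a morphism from a pullback at a section over `V`. -/
def evalUnit {M : Y.Modules} (β : (Scheme.Modules.pullback k).obj M ⟶ N) : Γ(M, V) →+ Γ(N, T) :=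
  (N.presheaf.map (homOfLE hT).op).hom.comp ((β.app (k ⁻¹ᵁ V)).hom.comp
    (((pullbackPushforwardAdjunction k).unit.app M).app V).hom)

lemma evalUnit_eq {M : Y.Modules} (β : (Scheme.Modules.pullback k).obj M ⟶ N) (m : Γ(M, V)) :
    evalUnit k hT β m = N.presheaf.map (homOfLE hT).op
      (((pullbackPushforwardAdjunction k).homEquiv M N β).app V m) := by
  rw [Adjunction.homEquiv_unit]
  rfl

lemma evalUnit_comp {M : Y.Modules} (β : (Scheme.Modules.pullback k).obj M ⟶ N) (ψ : N ⟶ N')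
    (m : Γ(M, V)) : evalUnit k hT (β ≫ ψ) m = ψ.app T (evalUnit k hT β m) :=
  (app_map ψ (homOfLE hT) _).symm

lemma evalUnit_smul {M : Y.Modules} (β : (Scheme.Modules.pullback k).obj M ⟶ N) (a : Γ(Y, V))
    (m : Γ(M, V)) : evalUnit k hT β (a • m) = k.appLE V T hT a • evalUnit k hT β m := by
  rw [evalUnit_eq, evalUnit_eq, Hom.app_smul]
  exact Scheme.Modules.map_smul N (homOfLE hT) (k.app V a) _

lemma evalUnit_map {M : Y.Modules} (β : (Scheme.Modules.pullback k).obj M ⟶ N) {V' : Y.Opens}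
    (h : V ≤ V') (hT' : T ≤ k ⁻¹ᵁ V') (m : Γ(M, V')) :
    evalUnit k hT β (M.presheaf.map (homOfLE h).op m) = evalUnit k hT' β m := by
  rw [evalUnit_eq, evalUnit_eq, app_map]
  exact map_map_apply N.presheaf (show k ⁻¹ᵁ V ≤ k ⁻¹ᵁ V' from fun x hx => h hx) hT _

/-- The derivation on `Γ(Y, V)` given by a morphism from `Ω|_X`. -/
def evalDifferentials (δ : restrictedDifferentials k ⟶ N) : Γ(Y, V) →+ Γ(N, T) :=
  (evalUnit k hT δ).comp (sectionsD Y V)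

lemma evalDifferentials_mul (δ : restrictedDifferentials k ⟶ N) (a b : Γ(Y, V)) :
    evalDifferentials k hT δ (a * b) = k.appLE V T hT a • evalDifferentials k hT δ b +
      k.appLE V T hT b • evalDifferentials k hT δ a := by
  change evalUnit k hT δ (sectionsD Y V (a * b)) = _
  rw [sectionsD_mul, map_add, evalUnit_smul, evalUnit_smul]
  rfl

lemma evalDifferentials_comp (δ : restrictedDifferentials k ⟶ N) (ψ : N ⟶ N') (a : Γ(Y, V)) :
    evalDifferentials k hT (δ ≫ ψ) a = ψ.app T (evalDifferentials k hT δ a) :=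
  evalUnit_comp k hT δ ψ _

variable (hV : IsAffineOpen V) (hN : SupportedOn N.presheaf T)
include hV hN

/-- Together with `exists_evalDifferentials_eq`: morphisms from `k^* Ω_{Y/ℤ}` to a module `N`
supported on `T` are the same as derivations from `Γ(Y, V)` to `Γ(N, T)`. -/
lemma evalDifferentials_injective {δ δ' : restrictedDifferentials k ⟶ N}
    (h : ∀ a, evalDifferentials k hT δ a = evalDifferentials k hT δ' a) : δ = δ' := by
  apply ((pullbackPushforwardAdjunction k).homEquiv _ _).injective
  refine differentials_hom_ext_of_supportedOn hV ((hN.mono hT).pushforward k) fun a => ?_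
  apply (hN.bijective_of_le hT).1
  have := h a
  change evalUnit k hT δ (sectionsD Y V a) = evalUnit k hT δ' (sectionsD Y V a) at this
  rw [evalUnit_eq, evalUnit_eq] at this
  exact this

lemma exists_evalDifferentials_eq (D : Γ(Y, V) →+ Γ(N, T))
    (hD : ∀ a b, D (a * b) = k.appLE V T hT a • D b + k.appLE V T hT b • D a) :
    ∃ δ : restrictedDifferentials k ⟶ N, ∀ a, evalDifferentials k hT δ a = D a := by
  let e : Γ((pushforward k).obj N, V) ≃+ Γ(N, T) :=
    AddEquiv.ofBijective (N.presheaf.map (homOfLE hT).op).hom (hN.bijective_of_le hT)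
  have he (a : Γ(Y, V)) (x : Γ((pushforward k).obj N, V)) :
      e (a • x) = k.appLE V T hT a • e x :=
    Scheme.Modules.map_smul N (homOfLE hT) (k.app V a) _
  obtain ⟨β, hβ⟩ := exists_differentials_hom hV ((hN.mono hT).pushforward k)
    (e.symm.toAddMonoidHom.comp D) (fun a b => by
      apply e.injective
      have he' (x : Γ(N, T)) : e (e.symm x) = x := e.apply_symm_apply x
      rw [map_add, he, he]
      exact ((he' _).trans (hD a b)).trans
        (congrArg₂ _ (congrArg _ (he' _).symm) (congrArg _ (he' _).symm)))
  refine ⟨((pullbackPushforwardAdjunction k).homEquiv _ _).symm β, fun a => ?_⟩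
  change evalUnit k hT _ (sectionsD Y V a) = _
  rw [evalUnit_eq, Equiv.apply_symm_apply, hβ]
  exact e.apply_symm_apply (D a)

variable [IsAffineHom k]

/-- Together with `exists_evalUnit_conormal_eq`: morphisms from `k^* I` to a module `N` supported on
`T` are the same as `Γ(Y, V)`-linear maps from `Γ(I, V)` to `Γ(N, T)`. -/
lemma evalUnit_conormal_injective {h h' : conormal k ⟶ N}
    (hh : ∀ s : Γ(idealModule k, V), evalUnit k hT h s = evalUnit k hT h' s) : h = h' := by
  apply ((pullbackPushforwardAdjunction k).homEquiv _ _).injective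
  refine hom_ext_of_supportedOn hV (isLocalizingOn_idealModule k hV)
    ((hN.mono hT).pushforward k) fun a => ?_
  apply (hN.bijective_of_le hT).1
  have := hh a
  rw [evalUnit_eq, evalUnit_eq] at this
  exact this

lemma exists_evalUnit_conormal_eq (φ : Γ(idealModule k, V) →+ Γ(N, T))
    (hφ : ∀ (a : Γ(Y, V)) s, φ (a • s) = k.appLE V T hT a • φ s) :
    ∃ h : conormal k ⟶ N, ∀ s : Γ(idealModule k, V), evalUnit k hT h s = φ s := by
  let e : Γ((pushforward k).obj N, V) ≃+ Γ(N, T) :=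
    AddEquiv.ofBijective (N.presheaf.map (homOfLE hT).op).hom (hN.bijective_of_le hT)
  have he (a : Γ(Y, V)) (x : Γ((pushforward k).obj N, V)) :
      e (a • x) = k.appLE V T hT a • e x :=
    Scheme.Modules.map_smul N (homOfLE hT) (k.app V a) _
  obtain ⟨β, hβ⟩ := exists_hom_of_linearMap hV (isLocalizingOn_idealModule k hV)
    ((hN.mono hT).pushforward k)
    { toFun := fun s => e.symm (φ s)
      map_add' := fun s t => by rw [map_add, map_add]
      map_smul' := fun a s => by
        apply e.injective
        have he' (x : Γ(N, T)) : e (e.symm x) = x := e.apply_symm_apply x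
        rw [RingHom.id_apply, he]
        exact ((he' _).trans (hφ a s)).trans (congrArg _ (he' _).symm) }
  refine ⟨((pullbackPushforwardAdjunction k).homEquiv _ _).symm β, fun a => ?_⟩
  rw [evalUnit_eq, Equiv.apply_symm_apply, hβ]
  exact e.apply_symm_apply (φ a)

end Eval

section EvalTransition
variable {X Y Z : Scheme.{0}} (k : X ⟶ Y) {V' : Y.Opens} {T : X.Opens} (hT : T ≤ k ⁻¹ᵁ V')
  {N : X.Modules}

/-- Composition with `I/I² ⟶ Ω|_X` restricts a derivation to the ideal. -/
lemma evalUnit_conormalMap (δ : restrictedDifferentials k ⟶ N) (s : Γ(idealModule k, V')) :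
    evalUnit k hT (conormalMap k ≫ δ) s = evalDifferentials k hT δ (idealIncl k V' s) := by
  have h1 := homEquiv_symm_app_unit k (conormalMapAux k) V' s
  exact congrArg (fun x => N.presheaf.map (homOfLE hT).op (δ.app (k ⁻¹ᵁ V') x)) h1

variable (f : Y ⟶ Z) {V : Z.Opens} (hV : V' ≤ f ⁻¹ᵁ V) (hT' : T ≤ (k ≫ f) ⁻¹ᵁ V)

lemma evalUnit_pullbackTransition {M : Z.Modules} {M' : Y.Modules}
    (φ : M ⟶ (pushforward f).obj M') (β : (Scheme.Modules.pullback k).obj M' ⟶ N) (m : Γ(M, V)) :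
    evalUnit (k ≫ f) hT' (pullbackTransition k f φ ≫ β) m =
      evalUnit k hT β (M'.presheaf.map (homOfLE hV).op (φ.app V m)) := by
  have h1 := homEquiv_symm_app_unit (k ≫ f) (φ ≫
    (pushforward f).map ((pullbackPushforwardAdjunction k).unit.app M') ≫
      (pushforwardComp k f).hom.app ((Scheme.Modules.pullback k).obj M')) V m
  refine (congrArg (fun x => N.presheaf.map (homOfLE hT').op (β.app ((k ≫ f) ⁻¹ᵁ V) x)) h1).trans ?_
  exact (evalUnit_map k hT β hV hT' _).symm

/-- Composition with the morphism of differentials induced by `f` composes a derivation with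
`f^#`. -/
lemma evalDifferentials_transition (δ : restrictedDifferentials k ⟶ N) (a : Γ(Z, V)) :
    evalDifferentials (k ≫ f) hT' (restrictedDifferentialsTransition k f ≫ δ) a =
      evalDifferentials k hT δ (f.appLE V V' hV a) := by
  refine (evalUnit_pullbackTransition k hT f hV hT' _ δ _).trans ?_
  rw [differentialsTransition_sectionsD]
  refine congrArg (evalUnit k hT δ) ?_
  exact (sectionsD_map (homOfLE hV) _).symm

lemma idealIncl_map_idealTransition (s : Γ(idealModule (k ≫ f), V)) :
    idealIncl k V' ((idealModule k).presheaf.map (homOfLE hV).op ((idealTransition k f).app V s)) =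
      f.appLE V V' hV (idealIncl (k ≫ f) V s) := by
  refine (idealIncl_map k (homOfLE hV) _).trans ?_
  rw [idealIncl_idealTransition]
  rfl

end EvalTransition

/-! ### Morphisms of schemes with a retraction on functions -/

section Retraction
variable {X Y Z : Scheme.{0}} (k : X ⟶ Y) (f : Y ⟶ Z) [IsAffineHom k] [IsAffineHom (k ≫ f)]

/-- If, on affine open sets, `f` has a section that is compatible with the maps from `X`, then the
square of the conormal sheaves and differentials of `k ≫ f` and `k` is `Hom`-exact: writing `A`, `B`
for the rings of functions and `J` for the ideal of `X` in `B`, the retraction `s : B ⟶ A` yields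
`B = A ⊕ ker s`, with `ker s ⊆ J`, and derivations of `B` are glued from derivations of `A` and
linear maps on `J`. -/
lemma isHomExact_of_retraction {V : Z.Opens} {V' : Y.Opens} (hV : IsAffineOpen V)
    (hV' : IsAffineOpen V') (hle : V' ≤ f ⁻¹ᵁ V) {T : X.Opens} (hT : k ⁻¹ᵁ V' = T)
    (hT' : (k ≫ f) ⁻¹ᵁ V = T) (s : Γ(Y, V') →+* Γ(Z, V)) (hs : ∀ a, s (f.appLE V V' hle a) = a)
    (hs' : ∀ b, (k ≫ f).appLE V T hT'.ge (s b) = k.appLE V' T hT.ge b) {N : X.Modules}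
    (hN : SupportedOn N.presheaf T) :
    IsHomExact (conormalMap (k ≫ f)) (conormalMap k) (conormalTransition k f)
      (restrictedDifferentialsTransition k f) N := by
  have hkf (a : Γ(Z, V)) : k.appLE V' T hT.ge (f.appLE V V' hle a) =
      (k ≫ f).appLE V T hT'.ge a := by
    rw [← ConcreteCategory.comp_apply, Scheme.Hom.appLE_comp_appLE]
  have hI (b : Γ(Y, V')) (hb : k.appLE V' T hT.ge b = 0) :
      ∃ t : Γ(idealModule k, V'), idealIncl k V' t = b := by
    apply exists_idealIncl_eq
    subst hT
    rwa [Scheme.Hom.appLE_eq_app] at hb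
  have hI' (a : Γ(Z, V)) (ha : (k ≫ f).appLE V T hT'.ge a = 0) :
      ∃ t : Γ(idealModule (k ≫ f), V), idealIncl (k ≫ f) V t = a := by
    apply exists_idealIncl_eq
    subst hT'
    rwa [Scheme.Hom.appLE_eq_app] at ha
  have hI0 (t : Γ(idealModule k, V')) : k.appLE V' T hT.ge (idealIncl k V' t) = 0 := by
    subst hT
    rw [Scheme.Hom.appLE_eq_app]
    exact app_idealIncl k t
  have tr (t : Γ(idealModule (k ≫ f), V)) (h : conormal k ⟶ N) :
      evalUnit (k ≫ f) hT'.ge (conormalTransition k f ≫ h) t = evalUnit k hT.ge h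
        ((idealModule k).presheaf.map (homOfLE hle).op ((idealTransition k f).app V t)) :=
    evalUnit_pullbackTransition k hT.ge f hle hT'.ge (idealTransition k f) h t
  have tr' (t : Γ(idealModule (k ≫ f), V)) := idealIncl_map_idealTransition k f hle t
  -- the projection of `B` to the kernel of the retraction
  have hπ (b : Γ(Y, V')) : ∃ t, idealIncl k V' t = b - f.appLE V V' hle (s b) :=
    hI _ (by rw [map_sub, hkf, hs', sub_self])
  choose π hπ using hπ
  refine ⟨fun δ δ' h1 h2 => ?_, fun h D hD => ?_, fun h => ?_⟩
  · refine evalDifferentials_injective k hT.ge hV' hN fun b => ?_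
    have e1 := evalUnit_conormalMap k hT.ge δ (π b)
    have e2 := evalUnit_conormalMap k hT.ge δ' (π b)
    have e3 := evalDifferentials_transition k hT.ge f hle hT'.ge δ (s b)
    have e4 := evalDifferentials_transition k hT.ge f hle hT'.ge δ' (s b)
    rw [h1, e2, hπ, map_sub, map_sub] at e1
    rw [h2, e4] at e3
    rw [e3] at e1
    exact (sub_left_injective e1).symm
  · let D' : Γ(Z, V) →+ Γ(N, T) := evalDifferentials (k ≫ f) hT'.ge D
    let h' : Γ(idealModule k, V') →+ Γ(N, T) := evalUnit k hT.ge h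
    have key (a : Γ(Z, V)) (t : Γ(idealModule k, V')) (ht : idealIncl k V' t = f.appLE V V' hle a)
        (ha : (k ≫ f).appLE V T hT'.ge a = 0) : h' t = D' a := by
      obtain ⟨u, rfl⟩ := hI' a ha
      have e1 := tr u h
      rw [hD, evalUnit_conormalMap] at e1
      refine Eq.trans ?_ e1.symm
      congr 1
      apply idealIncl_injective k V'
      rw [tr', ht]
    obtain ⟨δ, hδ⟩ := exists_evalDifferentials_eq k hT.ge hV' hN
      (AddMonoidHom.mk' (fun b => D' (s b) + h' (π b)) fun b c => by
        have : π (b + c) = π b + π c := by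
          apply idealIncl_injective k V'
          rw [map_add, hπ, hπ, hπ, map_add, map_add]
          ring
        rw [map_add, map_add, this, map_add]
        abel) (fun b c => by
        have : π (b * c) = b • π c + f.appLE V V' hle (s c) • π b := by
          apply idealIncl_injective k V'
          rw [map_add, idealIncl_smul, idealIncl_smul, hπ, hπ, hπ, map_mul, map_mul]
          ring
        have e1 : D' (s (b * c)) = k.appLE V' T hT.ge b • D' (s c) +
            k.appLE V' T hT.ge c • D' (s b) := by
          rw [map_mul, ← hs', ← hs']
          exact evalDifferentials_mul (k ≫ f) hT'.ge D (s b) (s c)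
        have e2 : h' (π (b * c)) = k.appLE V' T hT.ge b • h' (π c) +
            k.appLE V' T hT.ge c • h' (π b) := by
          rw [this, map_add]
          refine congrArg₂ _ (evalUnit_smul k hT.ge h _ _) ?_
          refine (evalUnit_smul k hT.ge h _ _).trans ?_
          rw [hkf, hs']
        change D' (s (b * c)) + h' (π (b * c)) = k.appLE V' T hT.ge b • (D' (s c) + h' (π c)) +
          k.appLE V' T hT.ge c • (D' (s b) + h' (π b))
        rw [e1, e2, smul_add, smul_add]
        abel)
    refine ⟨δ, ?_, ?_⟩
    · refine evalUnit_conormal_injective k hT.ge hV' hN fun t => ?_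
      rw [evalUnit_conormalMap, hδ]
      change D' (s (idealIncl k V' t)) + h' (π (idealIncl k V' t)) = h' t
      have e1 : h' (t - π (idealIncl k V' t)) = D' (s (idealIncl k V' t)) := by
        refine key _ _ ?_ ?_
        · rw [map_sub, hπ, sub_sub_cancel]
        · rw [hs', hI0]
      rw [← e1, map_sub, sub_add_cancel]
    · refine evalDifferentials_injective (k ≫ f) hT'.ge hV hN fun a => ?_
      rw [evalDifferentials_transition k hT.ge f hle hT'.ge, hδ]
      change D' (s (f.appLE V V' hle a)) + h' (π (f.appLE V V' hle a)) = D' a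
      have e1 : π (f.appLE V V' hle a) = 0 := by
        apply idealIncl_injective k V'
        rw [hπ, hs, sub_self, map_zero]
      rw [e1, hs, map_zero, add_zero]
  · have ht (j : Γ(idealModule k, V')) :
        ∃ t : Γ(idealModule (k ≫ f), V), idealIncl (k ≫ f) V t = s (idealIncl k V' j) :=
      hI' _ (by rw [hs', hI0])
    choose τ hτ using ht
    have inj := idealIncl_injective (k ≫ f) V
    obtain ⟨h', hh'⟩ := exists_evalUnit_conormal_eq k hT.ge hV' hN
      (AddMonoidHom.mk' (fun j => evalUnit (k ≫ f) hT'.ge h (τ j)) fun j j' => by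
        have : τ (j + j') = τ j + τ j' := inj (by rw [map_add, hτ, hτ, hτ, map_add, map_add])
        rw [this, map_add]) (fun b j => by
        have : τ (b • j) = s b • τ j :=
          inj (by rw [idealIncl_smul, hτ, hτ, idealIncl_smul, map_mul])
        change evalUnit (k ≫ f) hT'.ge h (τ (b • j)) = _
        rw [this, evalUnit_smul, hs']
        rfl)
    refine ⟨h', evalUnit_conormal_injective (k ≫ f) hT'.ge hV hN fun t => ?_⟩
    rw [tr, hh']
    change evalUnit (k ≫ f) hT'.ge h (τ _) = _
    congr 1
    apply inj
    rw [hτ, tr', hs]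

end Retraction

section Complex
variable {X Y Z : Scheme.{0}}

lemma IsHomExact.of_iso {C : Type*} [Category C] {K₁ K₀ L₁ L₀ K₁' K₀' L₁' L₀' : C}
    {dK : K₁ ⟶ K₀} {dL : L₁ ⟶ L₀} {a : K₁ ⟶ L₁} {b : K₀ ⟶ L₀}
    {dK' : K₁' ⟶ K₀'} {dL' : L₁' ⟶ L₀'} {a' : K₁' ⟶ L₁'} {b' : K₀' ⟶ L₀'} {N : C}
    (h : IsHomExact dK dL a b N) (eK₁ : K₁' ≅ K₁) (eK₀ : K₀' ≅ K₀) (eL₁ : L₁' ≅ L₁)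
    (eL₀ : L₀' ≅ L₀) (h₁ : dK' = eK₁.hom ≫ dK ≫ eK₀.inv) (h₂ : dL' = eL₁.hom ≫ dL ≫ eL₀.inv)
    (h₃ : a' = eK₁.hom ≫ a ≫ eL₁.inv) (h₄ : b' = eK₀.hom ≫ b ≫ eL₀.inv) :
    IsHomExact dK' dL' a' b' N := by
  subst h₁ h₂ h₃ h₄
  refine ⟨fun δ δ' h1 h2 => ?_, fun r D h1 => ?_, fun r => ?_⟩
  · rw [← cancel_epi eL₀.inv]
    refine h.inj _ _ ?_ ?_
    · simpa using h1
    · simpa using h2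
  · obtain ⟨δ, h2, h3⟩ := h.mid (eL₁.inv ≫ r) (eK₀.inv ≫ D) (by simpa using h1)
    refine ⟨eL₀.hom ≫ δ, ?_, ?_⟩
    · simp [h2]
    · simp [h3]
  · obtain ⟨h', hh⟩ := h.surj (eK₁.inv ≫ r)
    exact ⟨eL₁.hom ≫ h', by simp [hh]⟩

lemma isTwoTerm_cotangentComplex (k : X ⟶ Y) (hk : HasLocallyFreeTerms k) :
    IsTwoTerm ((underlyingComplex X).obj (cotangentComplex k hk)) := fun _ h h' =>
  (isVectorBundle X).ι.map_isZero (HomologicalComplex.isZero_double_X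
    (ObjectProperty.homMk (conormalMap k) :
    (⟨conormal k, hk.conormal⟩ : VectorBundle X) ⟶
      ⟨restrictedDifferentials k, hk.differentials⟩) rel_neg_one_zero _ h h')

/-- The identification of the term of degree `-1` with the conormal sheaf. -/
def conormalIso (k : X ⟶ Y) (hk : HasLocallyFreeTerms k) :
    ((underlyingComplex X).obj (cotangentComplex k hk)).X (-1) ≅ conormal k :=
  (isVectorBundle X).ι.mapIso (HomologicalComplex.doubleXIso₀ _ rel_neg_one_zero)

/-- The identification of the term of degree `0` with the restriction of the differentials. -/
def restrictedDifferentialsIso (k : X ⟶ Y) (hk : HasLocallyFreeTerms k) :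
    ((underlyingComplex X).obj (cotangentComplex k hk)).X 0 ≅ restrictedDifferentials k :=
  (isVectorBundle X).ι.mapIso (HomologicalComplex.doubleXIso₁ _ rel_neg_one_zero (by decide))

lemma cotangentComplex_d (k : X ⟶ Y) (hk : HasLocallyFreeTerms k) :
    ((underlyingComplex X).obj (cotangentComplex k hk)).d (-1) 0 =
      (conormalIso k hk).hom ≫ conormalMap k ≫ (restrictedDifferentialsIso k hk).inv := by
  refine (congrArg (isVectorBundle X).ι.map
    (HomologicalComplex.double_d (ObjectProperty.homMk (conormalMap k) :
    (⟨conormal k, hk.conormal⟩ : VectorBundle X) ⟶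
      ⟨restrictedDifferentials k, hk.differentials⟩) rel_neg_one_zero (by decide))).trans ?_
  rw [Functor.map_comp, Functor.map_comp]
  rfl

lemma transitionAux_f_neg_one (k : X ⟶ Y) (f : Y ⟶ Z) (hk : HasLocallyFreeTerms k)
    (hkf : HasLocallyFreeTerms (k ≫ f)) :
    ((underlyingComplex X).map (transitionAux k f hk hkf)).f (-1) =
      (conormalIso (k ≫ f) hkf).hom ≫ conormalTransition k f ≫ (conormalIso k hk).inv := by
  have h : (transitionAux k f hk hkf).hom.f (-1) =
      (HomologicalComplex.doubleXIso₀ _ rel_neg_one_zero).hom ≫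
        (ObjectProperty.homMk (conormalTransition k f) ≫
          (HomologicalComplex.doubleXIso₀ _ rel_neg_one_zero).inv) := by
    unfold transitionAux
    generalize_proofs
    apply HomologicalComplex.mkHomFromDouble_f₀ <;> assumption
  exact congrArg (isVectorBundle X).ι.map h

lemma transitionAux_f_zero (k : X ⟶ Y) (f : Y ⟶ Z) (hk : HasLocallyFreeTerms k)
    (hkf : HasLocallyFreeTerms (k ≫ f)) :
    ((underlyingComplex X).map (transitionAux k f hk hkf)).f 0 =
      (restrictedDifferentialsIso (k ≫ f) hkf).hom ≫ restrictedDifferentialsTransition k f ≫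
        (restrictedDifferentialsIso k hk).inv := by
  have h : (transitionAux k f hk hkf).hom.f 0 =
      (HomologicalComplex.doubleXIso₁ _ rel_neg_one_zero (by decide)).hom ≫
        (ObjectProperty.homMk (restrictedDifferentialsTransition k f) ≫
          (HomologicalComplex.doubleXIso₁ _ rel_neg_one_zero (by decide)).inv) := by
    unfold transitionAux
    generalize_proofs
    apply HomologicalComplex.mkHomFromDouble_f₁ <;> assumption
  exact congrArg (isVectorBundle X).ι.map h

lemma quasiIso_transitionAux (k : X ⟶ Y) (f : Y ⟶ Z) (hk : HasLocallyFreeTerms k)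
    (hkf : HasLocallyFreeTerms (k ≫ f))
    (h : ∀ x : X, ∃ T : X.Opens, x ∈ T ∧ ∀ N : T.toScheme.Modules,
      IsHomExact (conormalMap (k ≫ f)) (conormalMap k) (conormalTransition k f)
        (restrictedDifferentialsTransition k f) ((pushforward T.ι).obj N)) :
    quasiIso X (transitionAux k f hk hkf) := by
  refine quasiIso_of_isHomExact (isTwoTerm_cotangentComplex _ _) (isTwoTerm_cotangentComplex _ _) _
    fun x => ?_
  obtain ⟨T, hx, hT⟩ := h x
  exact ⟨T, hx, fun N => (hT N).of_iso (conormalIso _ hkf) (restrictedDifferentialsIso _ hkf)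
    (conormalIso _ hk) (restrictedDifferentialsIso _ hk) (cotangentComplex_d _ _)
    (cotangentComplex_d _ _) (transitionAux_f_neg_one ..) (transitionAux_f_zero ..)⟩

end Complex

/-! ### Functoriality of the morphisms of complexes -/

section Functoriality
variable {X Y P Z : Scheme.{0}}

lemma exists_idealIncl_eq_app {k : X ⟶ Y} {f : Y ⟶ Z} {i : X ⟶ Z} (h : k ≫ f = i) {V : Z.Opens}
    (s : Γ(idealModule i, V)) :
    ∃ t, idealIncl k (f ⁻¹ᵁ V) t = f.app V (idealIncl i V s) := by
  subst h
  exact ⟨_, idealIncl_idealTransition k f V s⟩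

/-- The term of degree `-1` of `transition` sends `s` to `f^# s`. The statement describes `f^# s` by
its image in `𝒪_Y`, so that it makes sense for `i` that is only propositionally equal to `k ≫ f`. -/
lemma exists_transition_f_neg_one (k : X ⟶ Y) (f : Y ⟶ Z) {i : X ⟶ Z} (h : k ≫ f = i)
    (hk : HasLocallyFreeTerms k) (hi : HasLocallyFreeTerms i) :
    ∃ c : conormal i ⟶ conormal k,
      ((underlyingComplex X).map (transition k f h hk hi)).f (-1) =
        (conormalIso i hi).hom ≫ c ≫ (conormalIso k hk).inv ∧
      ∀ {T : X.Opens} {V : Z.Opens} (hT : T ≤ i ⁻¹ᵁ V) (hT' : T ≤ k ⁻¹ᵁ f ⁻¹ᵁ V)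
        (s : Γ(idealModule i, V)) (t : Γ(idealModule k, f ⁻¹ᵁ V)),
        idealIncl k (f ⁻¹ᵁ V) t = f.app V (idealIncl i V s) →
        evalUnit i hT c s = evalUnit k hT' (𝟙 (conormal k)) t := by
  subst h
  refine ⟨conormalTransition k f, transitionAux_f_neg_one k f hk hi, fun {T V} hT hT' s t ht => ?_⟩
  have e := evalUnit_pullbackTransition k hT' f le_rfl hT (idealTransition k f) (𝟙 (conormal k)) s
  rw [Category.comp_id] at e
  refine e.trans ?_
  congr 1
  apply idealIncl_injective k
  rw [ht]
  refine (idealIncl_map_idealTransition k f le_rfl s).trans ?_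
  rw [Scheme.Hom.appLE_eq_app]

/-- The term of degree `0` of `transition` sends `da` to `d(f^# a)`. -/
lemma exists_transition_f_zero (k : X ⟶ Y) (f : Y ⟶ Z) {i : X ⟶ Z} (h : k ≫ f = i)
    (hk : HasLocallyFreeTerms k) (hi : HasLocallyFreeTerms i) :
    ∃ c : restrictedDifferentials i ⟶ restrictedDifferentials k,
      ((underlyingComplex X).map (transition k f h hk hi)).f 0 =
        (restrictedDifferentialsIso i hi).hom ≫ c ≫ (restrictedDifferentialsIso k hk).inv ∧
      ∀ {T : X.Opens} {V : Z.Opens} (hT : T ≤ i ⁻¹ᵁ V) (hT' : T ≤ k ⁻¹ᵁ f ⁻¹ᵁ V) (a : Γ(Z, V)),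
        evalDifferentials i hT c a =
          evalDifferentials k hT' (𝟙 (restrictedDifferentials k)) (f.app V a) := by
  subst h
  refine ⟨restrictedDifferentialsTransition k f, transitionAux_f_zero k f hk hi,
    fun {T V} hT hT' a => ?_⟩
  have e := evalDifferentials_transition k hT' f le_rfl hT (𝟙 (restrictedDifferentials k)) a
  rwa [Category.comp_id, Scheme.Hom.appLE_eq_app] at e

lemma conormal_hom_ext {i : X ⟶ Z} {N : X.Modules} {β γ : conormal i ⟶ N}
    (h : ∀ (V : Z.Opens) (s : Γ(idealModule i, V)),
      evalUnit i (T := i ⁻¹ᵁ V) le_rfl β s = evalUnit i (T := i ⁻¹ᵁ V) le_rfl γ s) : β = γ := by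
  apply hom_ext_of_unit i
  intro V s
  have := h V s
  change N.presheaf.map (homOfLE _).op _ = N.presheaf.map (homOfLE _).op _ at this
  rwa [map_self_apply, map_self_apply] at this

lemma restrictedDifferentials_hom_ext {i : X ⟶ Z} {N : X.Modules}
    {β γ : restrictedDifferentials i ⟶ N}
    (h : ∀ (V : Z.Opens) (a : Γ(Z, V)),
      evalDifferentials i (T := i ⁻¹ᵁ V) le_rfl β a =
        evalDifferentials i (T := i ⁻¹ᵁ V) le_rfl γ a) : β = γ := by
  apply ((pullbackPushforwardAdjunction i).homEquiv _ _).injective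
  apply differentials_hom_ext
  intro V a
  have := h V a
  change evalUnit i _ _ (sectionsD Z V a) = evalUnit i _ _ (sectionsD Z V a) at this
  rw [evalUnit_eq, evalUnit_eq] at this
  refine (map_self_apply N.presheaf le_rfl _).symm.trans (this.trans (map_self_apply _ le_rfl _))

lemma boundedComplex_hom_ext {K L : BoundedComplex X} {φ ψ : K ⟶ L}
    (h : ∀ n, ((underlyingComplex X).map φ).f n = ((underlyingComplex X).map ψ).f n) : φ = ψ := by
  exact ObjectProperty.hom_ext _ (HomologicalComplex.hom_ext _ _ fun n =>
    ObjectProperty.hom_ext _ (h n))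

/-- The morphisms of complexes induced by pulling back functions and differentials are
functorial. -/
lemma transition_comp {k : X ⟶ Y} {h : Y ⟶ P} {p : P ⟶ Z} {k₀ : X ⟶ P} {i : X ⟶ Z}
    (e : k ≫ h = k₀) (e₀ : k₀ ≫ p = i) (e' : k ≫ h ≫ p = i) (hk : HasLocallyFreeTerms k)
    (hk₀ : HasLocallyFreeTerms k₀) (hi : HasLocallyFreeTerms i) :
    transition k (h ≫ p) e' hk hi = transition k₀ p e₀ hk₀ hi ≫ transition k h e hk hk₀ := by
  have hV (V : Z.Opens) : i ⁻¹ᵁ V = k₀ ⁻¹ᵁ p ⁻¹ᵁ V := by subst e₀; rfl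
  have hV' (V : Z.Opens) : i ⁻¹ᵁ V = k ⁻¹ᵁ h ⁻¹ᵁ p ⁻¹ᵁ V := by rw [hV]; subst e; rfl
  apply boundedComplex_hom_ext
  intro n
  by_cases hn : n = -1
  · subst hn
    obtain ⟨c, hc, hc'⟩ := exists_transition_f_neg_one k (h ≫ p) e' hk hi
    obtain ⟨c₁, hc₁, hc₁'⟩ := exists_transition_f_neg_one k₀ p e₀ hk₀ hi
    obtain ⟨c₂, hc₂, hc₂'⟩ := exists_transition_f_neg_one k h e hk hk₀
    rw [Functor.map_comp, HomologicalComplex.comp_f, hc, hc₁, hc₂]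
    have : c = c₁ ≫ c₂ := by
      refine conormal_hom_ext fun V s => ?_
      obtain ⟨t, ht⟩ := exists_idealIncl_eq_app e₀ s
      obtain ⟨u, hu⟩ := exists_idealIncl_eq_app e t
      rw [evalUnit_comp, hc₁' _ (hV V).le s t ht, ← evalUnit_comp, Category.id_comp,
        hc₂' _ (hV' V).le t u hu]
      refine hc' _ (hV' V).le s u ?_
      refine hu.trans ?_
      rw [ht, Scheme.Hom.comp_app]
      rfl
    simp [this]
  by_cases hn' : n = 0
  · subst hn'
    obtain ⟨c, hc, hc'⟩ := exists_transition_f_zero k (h ≫ p) e' hk hi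
    obtain ⟨c₁, hc₁, hc₁'⟩ := exists_transition_f_zero k₀ p e₀ hk₀ hi
    obtain ⟨c₂, hc₂, hc₂'⟩ := exists_transition_f_zero k h e hk hk₀
    rw [Functor.map_comp, HomologicalComplex.comp_f, hc, hc₁, hc₂]
    have : c = c₁ ≫ c₂ := by
      refine restrictedDifferentials_hom_ext fun V a => ?_
      rw [evalDifferentials_comp, hc₁' _ (hV V).le, ← evalDifferentials_comp, Category.id_comp,
        hc₂' _ (hV' V).le]
      refine (hc' _ (hV' V).le a).trans ?_
      rw [Scheme.Hom.comp_app]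
      rfl
    simp [this]
  · exact (isTwoTerm_cotangentComplex i hi n hn hn').eq_of_src _ _

/-- `transition_comp` in the derived category: for `f = h ≫ p`, the morphism `f^*` factors through
`p^*`. -/
lemma derivedTransition_comp {k : X ⟶ Y} {h : Y ⟶ P} {p : P ⟶ Z} {k₀ : X ⟶ P} {i : X ⟶ Z}
    (e : k ≫ h = k₀) (e₀ : k₀ ≫ p = i) (e' : k ≫ h ≫ p = i) (hk : HasLocallyFreeTerms k)
    (hk₀ : HasLocallyFreeTerms k₀) (hi : HasLocallyFreeTerms i) :
    derivedTransition k (h ≫ p) e' hk hi =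
      derivedTransition k₀ p e₀ hk₀ hi ≫ derivedTransition k h e hk hk₀ := by
  rw [derivedTransition, transition_comp e e₀ e' hk hk₀ hi, Functor.map_comp]
  rfl

end Functoriality

/-! ### Regular local rings -/

section Regular
open IsLocalRing

lemma exists_finset_span_eq_maximalIdeal (S : Type*) [CommRing S] [IsLocalRing S]
    [IsNoetherianRing S] : ∃ s : Finset S, s.card = (maximalIdeal S).spanFinrank ∧
      Ideal.span (s : Set S) = maximalIdeal S := by
  have fg := (maximalIdeal S).fg_of_isNoetherianRing
  have fin := Submodule.FG.finite_generators fg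
  refine ⟨fin.toFinset, ?_, ?_⟩
  · rw [← Submodule.FG.generators_ncard fg, Set.ncard_eq_toFinset_card _ fin]
  · rw [Set.Finite.coe_toFinset]
    exact Submodule.span_generators _

lemma spanFinrank_maximalIdeal_le_card {S : Type*} [CommRing S] [IsLocalRing S] (s : Finset S)
    (hs : Ideal.span (s : Set S) = maximalIdeal S) :
    (maximalIdeal S).spanFinrank ≤ s.card := by
  rw [← hs, ← Set.ncard_coe_finset]
  exact Submodule.spanFinrank_span_le_ncard_of_finite s.finite_toSet

/-- An element of `𝔪` outside `𝔪²` is part of a minimal system of generators of `𝔪`. -/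
lemma exists_finset_span_insert_eq {S : Type*} [CommRing S] [IsLocalRing S]
    [IsNoetherianRing S] {x : S} (hx : x ∈ maximalIdeal S) (hx2 : x ∉ maximalIdeal S ^ 2) :
    ∃ s : Finset S, s.card + 1 = (maximalIdeal S).spanFinrank ∧
      Ideal.span (insert x (s : Set S)) = maximalIdeal S := by
  classical
  obtain ⟨s, hs, hspan⟩ := exists_finset_span_eq_maximalIdeal S
  rw [← hspan] at hx
  obtain ⟨a, -, ha⟩ := Submodule.mem_span_finset.1 hx
  have : ∃ y ∈ s, IsUnit (a y) := by
    by_contra! h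
    apply hx2
    rw [← ha, pow_two]
    refine Ideal.sum_mem _ fun y hy => Ideal.mul_mem_mul ?_ ?_
    · exact (mem_maximalIdeal _).2 (h y hy)
    · rw [← hspan]; exact Ideal.subset_span hy
  obtain ⟨y, hy, hu⟩ := this
  refine ⟨s.erase y, ?_, ?_⟩
  · rw [Finset.card_erase_add_one hy, hs]
  · apply le_antisymm
    · rw [← hspan, Ideal.span_le, Set.insert_subset_iff]
      exact ⟨hx, fun z hz => Ideal.subset_span (Finset.mem_of_mem_erase hz)⟩
    · rw [← hspan, Ideal.span_le]
      intro z hz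
      by_cases hzy : z = y
      · subst hzy
        rw [← Finset.add_sum_erase _ _ hy] at ha
        rw [SetLike.mem_coe, ← Ideal.unit_mul_mem_iff_mem _ hu, ← smul_eq_mul, eq_sub_of_add_eq ha]
        refine Ideal.sub_mem _ (Ideal.subset_span (Set.mem_insert _ _))
          (Ideal.sum_mem _ fun w hw => ?_)
        exact Ideal.mul_mem_left _ _ (Ideal.subset_span (Set.mem_insert_of_mem _ hw))
      · exact Ideal.subset_span (Set.mem_insert_of_mem _ (Finset.mem_erase.2 ⟨hzy, hz⟩))

/-- The quotient of a regular local ring by an element of `𝔪` outside `𝔪²` is regular, of dimension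
one less. -/
lemma isRegularLocalRing_quotient_span_singleton {S : Type*} [CommRing S] [IsRegularLocalRing S]
    {x : S} (hx : x ∈ maximalIdeal S) (hx2 : x ∉ maximalIdeal S ^ 2) :
    IsRegularLocalRing (S ⧸ Ideal.span {x}) ∧
      ringKrullDim (S ⧸ Ideal.span {x}) + 1 = ringKrullDim S := by
  classical
  have hle : Ideal.span {x} ≤ maximalIdeal S := (Ideal.span_singleton_le_iff_mem _).2 hx
  have : Nontrivial (S ⧸ Ideal.span {x}) :=
    Ideal.Quotient.nontrivial_iff.2 fun h =>
      (maximalIdeal.isMaximal S).ne_top (top_le_iff.1 (h ▸ hle))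
  let π := Ideal.Quotient.mk (Ideal.span {x})
  have hπ : Function.Surjective π := Ideal.Quotient.mk_surjective
  have : IsLocalRing (S ⧸ Ideal.span {x}) := IsLocalRing.of_surjective' π hπ
  obtain ⟨s, hs, hspan⟩ := exists_finset_span_insert_eq hx hx2
  have hmax : (maximalIdeal S).map π = maximalIdeal (S ⧸ Ideal.span {x}) := by
    apply IsLocalRing.eq_maximalIdeal
    refine Ideal.map_eq_top_or_isMaximal_of_surjective π hπ (maximalIdeal.isMaximal S)
      |>.resolve_left fun h => ?_
    have h1 := congrArg (Ideal.comap π) h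
    rw [Ideal.comap_map_of_surjective π hπ, Ideal.comap_top] at h1
    have h2 : Ideal.comap π ⊥ ≤ maximalIdeal S := by
      rw [← RingHom.ker_eq_comap_bot, Ideal.mk_ker]; exact hle
    rw [sup_eq_left.2 h2] at h1
    exact (maximalIdeal.isMaximal S).ne_top h1
  have h1 : (maximalIdeal (S ⧸ Ideal.span {x})).spanFinrank ≤ s.card := by
    refine (spanFinrank_maximalIdeal_le_card (s.image π) ?_).trans Finset.card_image_le
    rw [← hmax, ← hspan, Ideal.map_span, Finset.coe_image, Set.image_insert_eq,
      Ideal.Quotient.eq_zero_iff_mem.2 (Ideal.mem_span_singleton_self x), Ideal.span_insert_zero]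
  have h2 := ringKrullDim_le_spanFinrank_maximalIdeal (S ⧸ Ideal.span {x})
  have h3 := ringKrullDim_le_ringKrullDim_quotient_add_card (R := S) {x} (by
    rw [Finset.coe_singleton, Set.singleton_subset_iff, IsLocalRing.ringJacobson_eq_maximalIdeal]
    exact hx)
  rw [Finset.coe_singleton, Finset.card_singleton,
    ← IsRegularLocalRing.spanFinrank_maximalIdeal, ← hs] at h3
  push_cast at h3
  have h4 : (s.card : WithBot ℕ∞) ≤ ringKrullDim (S ⧸ Ideal.span {x}) := by
    exact (WithBot.add_le_add_iff_right' WithBot.one_ne_bot (by decide)).1 h3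
  refine ⟨IsRegularLocalRing.of_spanFinrank_maximalIdeal_le _ (le_trans (by exact_mod_cast h1) h4),
    ?_⟩
  rw [← IsRegularLocalRing.spanFinrank_maximalIdeal (R := S), ← hs, le_antisymm (h2.trans (by
    exact_mod_cast h1)) h4]
  push_cast
  rfl

/-- Regular local rings are domains. -/
lemma isDomain_of_isRegularLocalRing (n : ℕ) (S : Type*) [CommRing S] [IsRegularLocalRing S]
    (hn : ringKrullDim S = n) : IsDomain S := by
  induction n generalizing S with
  | zero =>
    have h : maximalIdeal S = ⊥ := by
      rw [← Submodule.spanFinrank_eq_zero_iff_eq_bot (maximalIdeal S).fg_of_isNoetherianRing]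
      have := IsRegularLocalRing.spanFinrank_maximalIdeal (R := S)
      rw [hn] at this
      exact_mod_cast this
    exact (IsLocalRing.isField_iff_maximalIdeal_eq.2 h).isDomain
  | succ n ih =>
    have hfin := minimalPrimes.finite_of_isNoetherianRing S
    -- prime avoidance
    have : ∃ x ∈ maximalIdeal S, x ∉ maximalIdeal S ^ 2 ∧ ∀ P ∈ minimalPrimes S, x ∉ P := by
      classical
      by_contra! h
      have h1 : ((maximalIdeal S : Ideal S) : Set S) ⊆
          ⋃ i ∈ ((insert (maximalIdeal S ^ 2) hfin.toFinset : Finset (Ideal S)) : Set (Ideal S)),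
            (i : Set S) := by
        intro x hx
        simp only [Finset.coe_insert, Set.Finite.coe_toFinset, Set.mem_insert_iff,
          Set.iUnion_iUnion_eq_or_left, Set.mem_union, Set.mem_iUnion]
        by_cases h2 : x ∈ maximalIdeal S ^ 2
        · exact Or.inl h2
        · obtain ⟨P, hP, hxP⟩ := h x hx h2
          exact Or.inr ⟨P, hP, hxP⟩
      obtain ⟨P, hP, hle⟩ := (Ideal.subset_union_prime (f := id) (maximalIdeal S ^ 2)
        (maximalIdeal S ^ 2) (fun i hi h2 _ => by
          rcases Finset.mem_insert.1 hi with rfl | hi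
          · exact absurd rfl h2
          · exact (hfin.mem_toFinset.1 hi).1.1)).1 h1
      have hht := IsLocalRing.maximalIdeal_height_eq_ringKrullDim (R := S)
      rw [hn] at hht
      rcases Finset.mem_insert.1 hP with rfl | hP
      · have : maximalIdeal S = ⊥ := by
          refine Submodule.eq_bot_of_le_smul_of_le_jacobson_bot (maximalIdeal S) _
            (maximalIdeal S).fg_of_isNoetherianRing ?_ ?_
          · rw [smul_eq_mul, ← pow_two]; exact hle
          · exact IsLocalRing.maximalIdeal_le_jacobson _
        rw [this, Ideal.height_bot] at hht
        exact absurd hht.symm (by exact_mod_cast Nat.succ_ne_zero n)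
      · have hP' := hfin.mem_toFinset.1 hP
        have : P.IsPrime := hP'.1.1
        have e : P = maximalIdeal S :=
          le_antisymm (IsLocalRing.le_maximalIdeal this.ne_top) hle
        rw [e, ← Ideal.height_eq_zero_iff] at hP'
        rw [hP'] at hht
        exact absurd hht.symm (by exact_mod_cast Nat.succ_ne_zero n)
    obtain ⟨x, hx, hx2, hxP⟩ := this
    obtain ⟨hreg, hdim⟩ := isRegularLocalRing_quotient_span_singleton hx hx2
    have hdom := ih (S ⧸ Ideal.span {x}) (by
      rw [hn, ← hreg.spanFinrank_maximalIdeal] at hdim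
      rw [← hreg.spanFinrank_maximalIdeal]
      have : (maximalIdeal (S ⧸ Ideal.span {x})).spanFinrank + 1 = n + 1 := by exact_mod_cast hdim
      rw [Nat.succ_injective this])
    have hprime : (Ideal.span {x}).IsPrime := (Ideal.Quotient.isDomain_iff_prime _).1 hdom
    obtain ⟨P, hP, hPle⟩ := Ideal.exists_minimalPrimes_le (bot_le : ⊥ ≤ Ideal.span {x})
    have hP' : P.IsPrime := hP.1.1
    have : P = ⊥ := by
      refine Submodule.eq_bot_of_le_smul_of_le_jacobson_bot (Ideal.span {x}) _
        P.fg_of_isNoetherianRing ?_ ?_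
      · intro p hp
        obtain ⟨q, rfl⟩ := Ideal.mem_span_singleton.1 (hPle hp)
        rw [smul_eq_mul]
        exact Ideal.mul_mem_mul (Ideal.mem_span_singleton_self x)
          ((hP'.mem_or_mem hp).resolve_left (hxP P hP))
      · exact ((Ideal.span_singleton_le_iff_mem _).2 hx).trans
          (IsLocalRing.maximalIdeal_le_jacobson _)
    rw [this] at hP'
    exact IsDomain.of_bot_isPrime S

end Regular

/-! ### Koszul-exact generators of the kernel -/

section Koszul
open IsLocalRing

/-- All relations between the elements `g i` are consequences of the relations
`g i * g j = g j * g i` (exactness of the Koszul complex in degree one). -/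
def IsKoszulExact {S : Type*} [CommRing S] {c : ℕ} (g : Fin c → S) : Prop :=
  ∀ a : Fin c → S, ∑ i, a i * g i = 0 →
    ∃ d : Fin c → Fin c → S, ∀ i, a i = ∑ j, (d i j - d j i) * g j

/-- The coefficients of a relation between the generators lie in the ideal `I` that they generate:
this is what makes their classes a basis of `I/I²`. -/
lemma IsKoszulExact.mem_span {S : Type*} [CommRing S] {c : ℕ} {g : Fin c → S}
    (hg : IsKoszulExact g) {a : Fin c → S} (ha : ∑ i, a i * g i = 0) (i : Fin c) :
    a i ∈ Ideal.span (Set.range g) := by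
  obtain ⟨d, hd⟩ := hg a ha
  rw [hd i]
  exact Ideal.sum_mem _ fun j _ => Ideal.mul_mem_left _ _ (Ideal.subset_span ⟨j, rfl⟩)

/-- A family that is Koszul-exact modulo a nonzerodivisor `x` remains so with `x` in front. -/
lemma IsKoszulExact.cons {S : Type*} [CommRing S] {c : ℕ} {x : S} {g : Fin c → S}
    (hx : x ∈ nonZeroDivisors S)
    (hg : IsKoszulExact fun i => Ideal.Quotient.mk (Ideal.span {x}) (g i)) :
    IsKoszulExact (Fin.cons x g : Fin (c + 1) → S) := by
  intro a ha
  rw [Fin.sum_univ_succ, Fin.cons_zero] at ha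
  simp only [Fin.cons_succ] at ha
  obtain ⟨d', hd'⟩ := hg (fun i => Ideal.Quotient.mk _ (a i.succ)) (by
    have := congrArg (Ideal.Quotient.mk (Ideal.span {x})) ha
    rw [map_add, map_mul, Ideal.Quotient.eq_zero_iff_mem.2 (Ideal.mem_span_singleton_self x),
      mul_zero, zero_add, map_sum, map_zero] at this
    simpa only [map_mul] using this)
  have hlift (i j) := Ideal.Quotient.mk_surjective (d' i j)
  choose d hd using hlift
  have hb (i : Fin c) : ∃ b, a i.succ = b * x + ∑ j, (d i j - d j i) * g j := by
    have : a i.succ - ∑ j, (d i j - d j i) * g j ∈ Ideal.span {x} := by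
      rw [← Ideal.Quotient.eq_zero_iff_mem, map_sub, map_sum, hd']
      simp only [map_mul, map_sub, hd, sub_self]
    obtain ⟨b, hb⟩ := Ideal.mem_span_singleton'.1 this
    exact ⟨b, by rw [hb, sub_add_cancel]⟩
  choose b hb using hb
  have h0 : ∑ i, ∑ j, (d i j - d j i) * g j * g i = 0 := by
    simp only [sub_mul, Finset.sum_sub_distrib]
    rw [sub_eq_zero, Finset.sum_comm]
    exact Finset.sum_congr rfl fun i _ => Finset.sum_congr rfl fun j _ => by ring
  have h1 : a 0 = -∑ i, b i * g i := by
    have h2 : (a 0 + ∑ i, b i * g i) * x = 0 := by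
      rw [← ha, add_mul, Finset.sum_mul, ← add_zero (∑ i, b i * g i * x), ← h0,
        ← Finset.sum_add_distrib]
      congr 1
      refine Finset.sum_congr rfl fun i _ => ?_
      rw [hb i, add_mul, Finset.sum_mul]
      ring
    exact eq_neg_of_add_eq_zero_left ((mul_right_mem_nonZeroDivisors_eq_zero_iff hx).1 h2)
  refine ⟨Fin.cons (fun _ => 0) fun i => Fin.cons (b i) (d i), fun i => ?_⟩
  refine Fin.cases ?_ (fun i => ?_) i
  · rw [h1, Fin.sum_univ_succ]
    simp [Finset.sum_neg_distrib]
  · rw [hb, Fin.sum_univ_succ]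
    simp

/-- The kernel of a surjection of regular local rings that is contained in `𝔪²` is zero. -/
lemma ker_eq_bot_of_le_sq {S R : Type*} [CommRing S] [CommRing R] [IsRegularLocalRing S]
    [IsRegularLocalRing R] [IsDomain S] (φ : S →+* R) (hφ : Function.Surjective φ)
    (h : RingHom.ker φ ≤ maximalIdeal S ^ 2) : RingHom.ker φ = ⊥ := by
  classical
  have := hφ.isLocalHom
  rw [eq_bot_iff]
  intro y hy
  by_contra hy0
  have h1 := ringKrullDim_succ_le_of_surjective φ hφ (mem_nonZeroDivisors_of_ne_zero hy0) hy
  rw [← IsRegularLocalRing.spanFinrank_maximalIdeal, ← IsRegularLocalRing.spanFinrank_maximalIdeal]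
    at h1
  obtain ⟨s, hs, hspan⟩ := exists_finset_span_eq_maximalIdeal R
  choose l hl using hφ
  have hcomap : maximalIdeal S ≤ Ideal.span (s.image l : Set S) := by
    refine Submodule.le_of_le_smul_of_le_jacobson_bot (I := maximalIdeal S)
      (maximalIdeal S).fg_of_isNoetherianRing (IsLocalRing.maximalIdeal_le_jacobson _) ?_
    intro z hz
    have hz' : φ z ∈ (Ideal.span (s.image l : Set S)).map φ := by
      rw [Ideal.map_span, Finset.coe_image, Set.image_image]
      simp only [hl, Set.image_id']
      rw [hspan]
      exact (mem_maximalIdeal _).2 fun hu => (mem_maximalIdeal _).1 hz (this.map_nonunit z hu)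
    obtain ⟨w, hw, hwz⟩ := (Ideal.mem_map_iff_of_surjective φ fun r => ⟨l r, hl r⟩).1 hz'
    refine Submodule.mem_sup.2 ⟨w, hw, z - w, ?_, by ring⟩
    rw [smul_eq_mul, ← pow_two]
    exact h (by rw [RingHom.mem_ker, map_sub, hwz, sub_self])
  have hle : Ideal.span (s.image l : Set S) ≤ maximalIdeal S := by
    rw [Ideal.span_le]
    intro z hz
    obtain ⟨w, hw, rfl⟩ := Finset.mem_image.1 hz
    refine (mem_maximalIdeal _).2 fun hu => ?_
    have hw' : w ∈ maximalIdeal R := by rw [← hspan]; exact Ideal.subset_span hw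
    exact hw' (by simpa [hl] using hu.map φ)
  have h2 := (spanFinrank_maximalIdeal_le_card _ (le_antisymm hle hcomap)).trans
    (Finset.card_image_le.trans hs.le)
  have h3 : (maximalIdeal R).spanFinrank + 1 ≤ (maximalIdeal S).spanFinrank := by
    exact_mod_cast h1
  omega

/-- The kernel of a surjection of regular local rings is generated by a Koszul-exact family. -/
lemma exists_isKoszulExact_span_eq_ker (n : ℕ) {S R : Type*} [CommRing S] [CommRing R]
    [IsRegularLocalRing S] [IsRegularLocalRing R] (hn : ringKrullDim S = n) (φ : S →+* R)
    (hφ : Function.Surjective φ) : ∃ (c : ℕ) (g : Fin c → S),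
      Ideal.span (Set.range g) = RingHom.ker φ ∧ IsKoszulExact g := by
  induction n using Nat.strong_induction_on generalizing S with
  | _ n ih =>
  have hdom := isDomain_of_isRegularLocalRing n S hn
  by_cases h : RingHom.ker φ ≤ maximalIdeal S ^ 2
  · refine ⟨0, Fin.elim0, ?_, fun a _ => ⟨fun i => i.elim0, fun i => i.elim0⟩⟩
    rw [ker_eq_bot_of_le_sq φ hφ h, Set.range_eq_empty, Ideal.span_empty]
  obtain ⟨x, hx, hx2⟩ := SetLike.not_le_iff_exists.1 h
  have hxm : x ∈ maximalIdeal S := IsLocalRing.le_maximalIdeal (RingHom.ker_ne_top φ) hx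
  obtain ⟨hreg, hdim⟩ := isRegularLocalRing_quotient_span_singleton hxm hx2
  rw [hn, ← hreg.spanFinrank_maximalIdeal] at hdim
  have hdim' : (maximalIdeal (S ⧸ Ideal.span {x})).spanFinrank + 1 = n := by exact_mod_cast hdim
  have hker : ∀ a ∈ Ideal.span {x}, φ a = 0 := fun a ha =>
    (Ideal.span_singleton_le_iff_mem _).2 hx ha
  obtain ⟨c, g', hspan, hg'⟩ := ih _ (by omega) hreg.spanFinrank_maximalIdeal.symm
    (Ideal.Quotient.lift (Ideal.span {x}) φ hker)
    (Ideal.Quotient.lift_surjective_of_surjective _ _ hφ)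
  have hlift (i) := Ideal.Quotient.mk_surjective (g' i)
  choose g hg using hlift
  refine ⟨c + 1, Fin.cons x g, ?_, IsKoszulExact.cons
    (mem_nonZeroDivisors_of_ne_zero fun h0 => hx2 (h0 ▸ Ideal.zero_mem _)) ?_⟩
  · rw [Fin.range_cons]
    apply le_antisymm
    · rw [Ideal.span_le, Set.insert_subset_iff]
      refine ⟨hx, ?_⟩
      rintro _ ⟨i, rfl⟩
      have : g' i ∈ RingHom.ker (Ideal.Quotient.lift (Ideal.span {x}) φ hker) := by
        rw [← hspan]; exact Ideal.subset_span ⟨i, rfl⟩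
      rwa [← hg, RingHom.mem_ker, Ideal.Quotient.lift_mk] at this
    · intro y hy
      have hy' : Ideal.Quotient.mk (Ideal.span {x}) y ∈
          (Ideal.span (Set.range g)).map (Ideal.Quotient.mk (Ideal.span {x})) := by
        rw [Ideal.map_span, ← Set.range_comp]
        have : Ideal.Quotient.mk (Ideal.span {x}) ∘ g = g' := funext hg
        rwa [this, hspan, RingHom.mem_ker, Ideal.Quotient.lift_mk]
      obtain ⟨z, hz, hzy⟩ :=
        (Ideal.mem_map_iff_of_surjective _ Ideal.Quotient.mk_surjective).1 hy'
      rw [Ideal.span_insert]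
      refine Submodule.mem_sup.2 ⟨y - z, ?_, z, hz, by ring⟩
      rw [← Ideal.Quotient.eq_zero_iff_mem, map_sub, hzy, sub_self]
  · simpa only [hg] using hg'

end Koszul

section Spread

/-- A finitely generated submodule that lies in `P` after localization at `p` lies in `P` up to one
element outside `p`. -/
lemma exists_notMem_smul_mem {A M : Type*} [CommRing A] [AddCommGroup M] [Module A M] (p : Ideal A)
    [p.IsPrime] {K P : Submodule A M} (hK : K.FG) (h : ∀ a ∈ K, ∃ f ∉ p, f • a ∈ P) :
    ∃ f ∉ p, ∀ a ∈ K, f • a ∈ P := by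
  classical
  obtain ⟨s, rfl⟩ := hK
  choose! f hf hfP using h
  refine ⟨∏ a ∈ s, f a, fun hp => ?_, fun a ha => ?_⟩
  · obtain ⟨a, ha, hap⟩ := (Ideal.IsPrime.prod_mem_iff (hp := ‹_›)).1 hp
    exact hf a (Submodule.subset_span ha) hap
  · have : Submodule.span A (s : Set M) ≤ P.comap (LinearMap.lsmul A M (∏ a ∈ s, f a)) := by
      rw [Submodule.span_le]
      intro b hb
      rw [SetLike.mem_coe, Submodule.mem_comap, LinearMap.lsmul_apply,
        ← Finset.prod_erase_mul _ _ hb, mul_smul]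
      exact P.smul_mem _ (hfP b (Submodule.subset_span hb))
    exact this ha

/-- A surjection `A ⟶ R` of rings whose local rings at `p` and `q` are regular is, near `p`, the
quotient by an ideal with generators `g i`, such that the coefficients of all relations between
them lie in this ideal. -/
lemma exists_generators_ker {A R B : Type*} [CommRing A] [CommRing R] [CommRing B]
    [IsRegularRing A] (φ : A →+* R) (hφ : Function.Surjective φ) (q : Ideal R) [q.IsPrime]
    [Algebra R B] [IsLocalization.AtPrime B q] [IsRegularLocalRing B] :
    ∃ f, φ f ∉ q ∧ ∃ (c : ℕ) (g : Fin c → A), (∀ i, φ (g i) = 0) ∧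
      (∀ a, φ a = 0 → f * a ∈ Ideal.span (Set.range g)) ∧
      ∀ a : Fin c → A, ∑ i, a i * g i = 0 → ∀ i, φ (f * a i) = 0 := by
  let p := q.comap φ
  let S := Localization.AtPrime p
  have hreg : IsRegularLocalRing S := IsRegularRing.isRegularLocalRing_localization p
  have hpq : p.primeCompl ≤ q.primeCompl.comap φ := fun a ha => ha
  let ψ : S →+* B := IsLocalization.map B φ hpq
  have hψ (a : A) : ψ (algebraMap A S a) = algebraMap R B (φ a) := IsLocalization.map_eq hpq a
  have hψs : Function.Surjective ψ := by
    intro b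
    obtain ⟨⟨r, s⟩, h⟩ := IsLocalization.surj q.primeCompl b
    obtain ⟨a, rfl⟩ := hφ r
    obtain ⟨t, ht⟩ := hφ s
    have htp : t ∈ p.primeCompl := fun h1 => s.2 (by rw [← ht]; exact h1)
    refine ⟨IsLocalization.mk' S a ⟨t, htp⟩, ?_⟩
    rw [IsLocalization.map_mk', IsLocalization.mk'_eq_iff_eq_mul, ← h]
    simp [ht]
  have hker (a : A) (ha : ψ (algebraMap A S a) = 0) : ∃ t ∉ p, φ (t * a) = 0 := by
    rw [hψ, IsLocalization.map_eq_zero_iff q.primeCompl] at ha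
    obtain ⟨s, hs⟩ := ha
    obtain ⟨t, ht⟩ := hφ s
    exact ⟨t, fun h1 => s.2 (by rw [← ht]; exact h1), by rw [map_mul, ht, hs]⟩
  obtain ⟨c, g₀, hspan, hg₀⟩ := exists_isKoszulExact_span_eq_ker _
    hreg.spanFinrank_maximalIdeal.symm ψ hψs
  -- clear denominators, such that the generators come from the kernel of `φ`
  have hclear (i : Fin c) : ∃ (a : A) (u : S), IsUnit u ∧
      algebraMap A S a = u * g₀ i ∧ φ a = 0 := by
    obtain ⟨⟨a, s⟩, has⟩ := IsLocalization.surj p.primeCompl (g₀ i)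
    have h0 : g₀ i ∈ RingHom.ker ψ := by rw [← hspan]; exact Ideal.subset_span ⟨i, rfl⟩
    obtain ⟨t, ht, hta⟩ := hker a (by rw [← has, map_mul, h0, zero_mul])
    refine ⟨t * a, algebraMap A S t * algebraMap A S s, ?_, ?_, hta⟩
    · exact (IsLocalization.map_units S (⟨t, ht⟩ : p.primeCompl)).mul (IsLocalization.map_units S s)
    · rw [map_mul, ← has]; ring
  choose g u hu hgu hφg using hclear
  have hmap : (Ideal.span (Set.range g)).map (algebraMap A S) = RingHom.ker ψ := by
    rw [← hspan, Ideal.map_span, ← Set.range_comp]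
    apply le_antisymm
    · rw [Ideal.span_le]
      rintro _ ⟨i, rfl⟩
      rw [Function.comp_apply, hgu]
      exact Ideal.mul_mem_left _ _ (Ideal.subset_span ⟨i, rfl⟩)
    · rw [Ideal.span_le]
      rintro _ ⟨i, rfl⟩
      rw [SetLike.mem_coe, ← Ideal.unit_mul_mem_iff_mem _ (hu i), ← hgu]
      exact Ideal.subset_span ⟨i, rfl⟩
  obtain ⟨f₁, hf₁, h₁⟩ := exists_notMem_smul_mem p (K := RingHom.ker φ)
    (P := Ideal.span (Set.range g)) (RingHom.ker φ).fg_of_isNoetherianRing (fun a ha => by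
      have h1 : algebraMap A S a ∈ (Ideal.span (Set.range g)).map (algebraMap A S) := by
        rw [hmap, RingHom.mem_ker, hψ, (RingHom.mem_ker).1 ha, map_zero]
      obtain ⟨t, ht, hta⟩ :=
        (IsLocalization.algebraMap_mem_map_algebraMap_iff p.primeCompl S _ _).1 h1
      exact ⟨t, ht, hta⟩)
  obtain ⟨f₂, hf₂, h₂⟩ := exists_notMem_smul_mem p
    (K := LinearMap.ker (Fintype.linearCombination A g))
    (P := Submodule.pi Set.univ fun _ => RingHom.ker φ) (IsNoetherian.noetherian _) (fun a ha => by
      have h1 : ∑ i, a i * g i = 0 := by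
        simpa [Fintype.linearCombination_apply] using ha
      have h2 : ∑ i, (algebraMap A S (a i) * u i) * g₀ i = 0 := by
        rw [← map_zero (algebraMap A S), ← h1, map_sum]
        refine Finset.sum_congr rfl fun i _ => ?_
        rw [map_mul, hgu, mul_assoc]
      have h3 (i : Fin c) : ∃ t ∉ p, φ (t * a i) = 0 := by
        refine hker _ ?_
        have h4 := hg₀.mem_span h2 i
        rw [hspan, Ideal.mul_unit_mem_iff_mem _ (hu i)] at h4
        exact h4
      choose t ht hta using h3
      refine ⟨∏ i, t i, fun hp => ?_, fun i _ => ?_⟩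
      · obtain ⟨i, -, hi⟩ := (Ideal.IsPrime.prod_mem_iff (hp := inferInstance)).1 hp
        exact ht i hi
      · classical
        rw [Pi.smul_apply, ← Finset.prod_erase_mul _ _ (Finset.mem_univ i), mul_smul]
        exact Ideal.mul_mem_left _ _ (hta i))
  refine ⟨f₁ * f₂, fun h => ?_, c, g, hφg, fun a ha => ?_, fun a ha i => ?_⟩
  · exact ((inferInstance : p.IsPrime).mem_or_mem h).elim hf₁ hf₂
  · rw [mul_comm f₁, mul_assoc]
    exact Ideal.mul_mem_left _ _ (h₁ a ha)
  · have h3 : φ (f₂ * a i) = 0 :=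
      h₂ a (by simpa [Fintype.linearCombination_apply] using ha) i (Set.mem_univ i)
    rw [mul_assoc, map_mul, h3, mul_zero]

end Spread

/-! ### Local freeness of the conormal sheaf and of the differentials -/

section LocallyFree

/-- A module `M` is free of rank `r` on `T` if morphisms from `M` to modules that are supported on
`T` are naturally the same as `r`-tuples of sections over `T`. -/
lemma nonempty_restrict_iso_free_of_supportedOn {X : Scheme.{0}} {M : X.Modules} {T : X.Opens}
    {r : ℕ} (ev : ∀ N : X.Modules, (M ⟶ N) → Fin r → Γ(N, T))
    (hev : ∀ N, SupportedOn N.presheaf T → Function.Bijective (ev N))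
    (nat : ∀ (N N' : X.Modules) (ψ : N ⟶ N') (β : M ⟶ N) (j),
      ev N' (β ≫ ψ) j = ψ.app T (ev N β j)) :
    Nonempty (M.restrict T.ι ≅
      (SheafOfModules.free (R := T.toScheme.ringCatSheaf) (Fin r) : T.toScheme.Modules)) := by
  have hle : (⊤ : T.toScheme.Opens) ≤ T.ι ⁻¹ᵁ T := T.ι_preimage_self.ge
  have hbij (N : T.toScheme.Modules) : Function.Bijective (N.presheaf.map (homOfLE hle).op) :=
    bijective_map_of_eq N.presheaf T.ι_preimage_self.symm hle
  refine nonempty_restrict_iso_free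
    (fun N β j => N.presheaf.map (homOfLE hle).op (ev _ β j)) (fun N => ?_) fun N N' ψ β j => ?_
  · exact ((hbij N).comp_left (α := Fin r)).comp (hev _ (supportedOn_pushforward_ι T N))
  · refine (congrArg (N'.presheaf.map (homOfLE hle).op) (nat _ _ _ β j)).trans ?_
    exact (app_map ψ (homOfLE hle) _).symm

/-- If the `t i` generate `M` up to multiplication by `f`, which `ψ` sends to a unit, then
semilinear maps from `M` are determined by their values at the `t i`. -/
lemma semilinear_ext {A R M N : Type*} [CommRing A] [CommRing R] [AddCommGroup M] [Module A M]
    [AddCommGroup N] [Module R N] (ψ : A →+* R) {c : ℕ} {t : Fin c → M} {f : A}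
    (hf : IsUnit (ψ f)) (ht : ∀ s, ∃ b : Fin c → A, f • s = ∑ i, b i • t i) {h h' : M →+ N}
    (hh : ∀ a s, h (a • s) = ψ a • h s) (hh' : ∀ a s, h' (a • s) = ψ a • h' s)
    (H : ∀ i, h (t i) = h' (t i)) (s : M) : h s = h' s := by
  obtain ⟨b, hb⟩ := ht s
  apply hf.smul_left_cancel.1
  rw [← hh, ← hh', hb, map_sum, map_sum]
  simp only [hh, hh', H]

/-- If moreover `ψ` kills the coefficients of all relations between the `t i`, then the values of a
semilinear map at the `t i` can be prescribed. -/
lemma exists_semilinear {A R M N : Type*} [CommRing A] [CommRing R] [AddCommGroup M] [Module A M]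
    [AddCommGroup N] [Module R N] (ψ : A →+* R) {c : ℕ} {t : Fin c → M} {f : A}
    (hf : IsUnit (ψ f)) (ht : ∀ s, ∃ b : Fin c → A, f • s = ∑ i, b i • t i)
    (ht0 : ∀ b : Fin c → A, ∑ i, b i • t i = 0 → ∀ i, ψ (b i) = 0) (n : Fin c → N) :
    ∃ h : M →+ N, (∀ a s, h (a • s) = ψ a • h s) ∧ ∀ i, h (t i) = n i := by
  choose b hb using ht
  obtain ⟨u, hu⟩ := hf
  have key (s : M) (a : A) (b' : Fin c → A) (hb' : (a * f) • s = ∑ i, b' i • t i) :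
      ∑ i, ψ (b' i) • n i = ψ a • ∑ i, ψ (b s i) • n i := by
    have h0 : ∑ i, (b' i - a * b s i) • t i = 0 := by
      simp only [sub_smul, Finset.sum_sub_distrib, mul_smul, ← Finset.smul_sum]
      rw [← hb', ← hb, mul_smul, sub_self]
    rw [Finset.smul_sum]
    refine Finset.sum_congr rfl fun i _ => ?_
    have := ht0 _ h0 i
    rw [map_sub, sub_eq_zero, map_mul] at this
    rw [this, mul_smul]
  have hval (s : M) (a : A) (b' : Fin c → A) (hb' : (a * f) • s = ∑ i, b' i • t i) :
      (↑u⁻¹ : R) • ∑ i, ψ (b' i) • n i = ψ a • (↑u⁻¹ : R) • ∑ i, ψ (b s i) • n i := by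
    rw [key s a b' hb', smul_comm]
  refine ⟨AddMonoidHom.mk' (fun s => (↑u⁻¹ : R) • ∑ i, ψ (b s i) • n i) fun s s' => ?_,
    fun a s => ?_, fun i => ?_⟩
  · have := hval (s + s') 1 (b s + b s') (by
      rw [one_mul, smul_add, hb, hb, ← Finset.sum_add_distrib]
      simp only [Pi.add_apply, add_smul])
    rw [map_one, one_smul] at this
    rw [← this, ← smul_add, ← Finset.sum_add_distrib]
    simp only [Pi.add_apply, map_add, add_smul]
  · exact hval s a (b (a • s)) (by rw [← hb, mul_comm, mul_smul])
  · classical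
    have := hval (t i) 1 (Pi.single i f) (by
      rw [one_mul, Finset.sum_eq_single i]
      · rw [Pi.single_eq_same]
      · intro j _ hj
        rw [Pi.single_eq_of_ne hj, zero_smul]
      · simp)
    rw [map_one, one_smul] at this
    change (↑u⁻¹ : R) • ∑ j, ψ (b (t i) j) • n j = n i
    rw [← this, Finset.sum_eq_single i]
    · rw [Pi.single_eq_same, ← hu, smul_smul, Units.inv_mul, one_smul]
    · intro j _ hj
      rw [Pi.single_eq_of_ne hj, map_zero, zero_smul]
    · simp

variable {X Y : Scheme.{0}} (k : X ⟶ Y)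

/-- The conormal sheaf of a regular scheme in a regular scheme is locally free: a Koszul-exact
family of generators of the ideal is a basis of `I/I²`. -/
lemma isVectorBundle_conormal [IsClosedImmersion k] (hreg : IsRegularScheme X)
    (hY : ∀ x : X, ∃ V : Y.Opens, IsAffineOpen V ∧ k x ∈ V ∧ IsRegularRing Γ(Y, V)) :
    isVectorBundle X (conormal k) := by
  intro x
  obtain ⟨V, hV, hxV, hA⟩ := hY x
  have hU : IsAffineOpen (k ⁻¹ᵁ V) := hV.preimage k
  let xU : (k ⁻¹ᵁ V : X.Opens) := ⟨x, hxV⟩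
  let _ : Algebra Γ(X, k ⁻¹ᵁ V) (X.presheaf.stalk x) := X.presheaf.algebra_section_stalk xU
  have hloc : IsLocalization.AtPrime (X.presheaf.stalk x) (hU.primeIdealOf xU).asIdeal :=
    hU.isLocalization_stalk xU
  have := hreg x
  obtain ⟨f, hf, c, g, hg, hgen, hrel⟩ := exists_generators_ker (k.app V).hom
    (k.app_surjective V hV) (hU.primeIdealOf xU).asIdeal (B := X.presheaf.stalk x)
  have hg' (i : Fin c) := exists_idealIncl_eq k (g i) (hg i)
  choose t ht using hg'
  let T : X.Opens := X.basicOpen (k.app V f)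
  have hT : T ≤ k ⁻¹ᵁ V := X.basicOpen_le _
  have hxT : x ∈ T := by
    rw [Scheme.mem_basicOpen X (k.app V f) x hxV]
    exact (IsLocalization.AtPrime.isUnit_to_map_iff (X.presheaf.stalk x)
      (hU.primeIdealOf xU).asIdeal _).2 hf
  have hunit : IsUnit ((k.appLE V T hT).hom f) :=
    RingedSpace.isUnit_res_basicOpen _ (k.app V f)
  have hψ (a : Γ(Y, V)) (ha : k.app V a = 0) : (k.appLE V T hT).hom a = 0 := by
    change X.presheaf.map _ (k.app V a) = 0
    rw [ha, map_zero]
  have h1 (s : Γ(idealModule k, V)) : ∃ b : Fin c → Γ(Y, V), f • s = ∑ i, b i • t i := by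
    obtain ⟨b, hb⟩ := (Ideal.mem_span_range_iff_exists_fun).1 (hgen _ (app_idealIncl k s))
    refine ⟨b, idealIncl_injective k V ?_⟩
    rw [map_sum, idealIncl_smul, ← hb]
    exact Finset.sum_congr rfl fun i _ => by rw [idealIncl_smul, ht]
  have h2 (b : Fin c → Γ(Y, V)) (hb : ∑ i, b i • t i = 0) (i : Fin c) :
      (k.appLE V T hT).hom (b i) = 0 := by
    have h3 := hrel b (by
      rw [← map_zero (idealIncl k V), ← hb, map_sum]
      exact Finset.sum_congr rfl fun i _ => by rw [idealIncl_smul, ht]) i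
    have h4 := hψ _ h3
    rw [map_mul] at h4
    exact hunit.mul_right_eq_zero.1 h4
  refine ⟨T, hxT, c, nonempty_restrict_iso_free_of_supportedOn
    (fun N β j => evalUnit k hT β (t j)) (fun N hN => ⟨fun β β' h => ?_, fun n => ?_⟩)
    fun N N' ψ β j => evalUnit_comp k hT β ψ (t j)⟩
  · refine evalUnit_conormal_injective k hT hV hN fun s => ?_
    exact semilinear_ext (k.appLE V T hT).hom hunit h1 (evalUnit_smul k hT β)
      (evalUnit_smul k hT β') (congrFun h) s
  · obtain ⟨φ, hφ, hφt⟩ := exists_semilinear (k.appLE V T hT).hom hunit h1 h2 n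
    obtain ⟨h, hh⟩ := exists_evalUnit_conormal_eq k hT hV hN φ hφ
    exact ⟨h, funext fun j => (hh _).trans (hφt j)⟩

lemma derivation_ext_mvPolynomial {A R M : Type*} [CommRing A] [CommRing R] [AddCommGroup M]
    [Module R M] {N : ℕ} (e : MvPolynomial (Fin N) ℤ ≃+* A) (ψ : A →+* R) {D D' : A →+ M}
    (hD : ∀ a b, D (a * b) = ψ a • D b + ψ b • D a)
    (hD' : ∀ a b, D' (a * b) = ψ a • D' b + ψ b • D' a)
    (h : ∀ i, D (e (.X i)) = D' (e (.X i))) (a : A) : D a = D' a := by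
  obtain ⟨a, rfl⟩ := e.surjective a
  have h1 : D 1 = 0 := by simpa using hD 1 1
  have h1' : D' 1 = 0 := by simpa using hD' 1 1
  induction a using MvPolynomial.induction_on with
  | C n =>
    rw [eq_intCast, map_intCast, ← zsmul_one, map_zsmul, map_zsmul, h1, h1']
  | add p q hp hq => rw [map_add, map_add, map_add, hp, hq]
  | mul_X p i hp => rw [map_mul, hD, hD', h, hp]

lemma exists_derivation_mvPolynomial {A R M : Type*} [CommRing A] [CommRing R] [AddCommGroup M]
    [Module R M] {N : ℕ} (e : MvPolynomial (Fin N) ℤ ≃+* A) (ψ : A →+* R) (m : Fin N → M) :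
    ∃ D : A →+ M, (∀ a b, D (a * b) = ψ a • D b + ψ b • D a) ∧ ∀ i, D (e (.X i)) = m i := by
  let _ : Module (MvPolynomial (Fin N) ℤ) M :=
    Module.compHom M (ψ.comp (e : MvPolynomial (Fin N) ℤ →+* A))
  have hsmul (a : MvPolynomial (Fin N) ℤ) (x : M) : a • x = ψ (e a) • x := rfl
  let D := MvPolynomial.mkDerivation ℤ m
  refine ⟨(D : MvPolynomial (Fin N) ℤ →ₗ[ℤ] M).toAddMonoidHom.comp e.symm.toAddMonoidHom,
    fun a b => ?_, fun i => ?_⟩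
  · change D (e.symm (a * b)) = ψ a • D (e.symm b) + ψ b • D (e.symm a)
    rw [map_mul, D.leibniz, hsmul, hsmul, e.apply_symm_apply, e.apply_symm_apply]
  · change D (e.symm (e _)) = _
    rw [e.symm_apply_apply]
    exact MvPolynomial.mkDerivation_X ℤ m i

/-- The restriction of the differentials of a scheme that is covered by affine spaces is locally
free. -/
lemma isVectorBundle_restrictedDifferentials
    (hY : ∀ x : X, ∃ V : Y.Opens, IsAffineOpen V ∧ k x ∈ V ∧
      ∃ N : ℕ, Nonempty (MvPolynomial (Fin N) ℤ ≃+* Γ(Y, V))) :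
    isVectorBundle X (restrictedDifferentials k) := by
  intro x
  obtain ⟨V, hV, hxV, N, ⟨e⟩⟩ := hY x
  refine ⟨k ⁻¹ᵁ V, hxV, N, nonempty_restrict_iso_free_of_supportedOn
    (fun N β j => evalDifferentials k le_rfl β (e (.X j)))
    (fun N hN => ⟨fun β β' h => ?_, fun n => ?_⟩)
    fun N N' ψ β j => evalDifferentials_comp k le_rfl β ψ _⟩
  · refine evalDifferentials_injective k le_rfl hV hN fun a => ?_
    exact derivation_ext_mvPolynomial e (k.appLE V _ le_rfl).hom
      (evalDifferentials_mul k le_rfl β) (evalDifferentials_mul k le_rfl β') (congrFun h) a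
  · obtain ⟨D, hD, hDm⟩ := exists_derivation_mvPolynomial e (k.appLE V _ le_rfl).hom n
    obtain ⟨h, hh⟩ := exists_evalDifferentials_eq k le_rfl hV hN D hD
    exact ⟨h, funext fun j => (hh _).trans (hDm j)⟩

end LocallyFree

/-! ### Charts of projective space -/

section ProjectiveSpace
open MvPolynomial

/-- Euler's scaling rule; with `u = x_i` and `y_j = x_j / x_i` it recovers a homogeneous polynomial
from its dehomogenization. -/
lemma eval₂_mul_of_isHomogeneous {σ R L : Type*} [Fintype σ] [CommRing R] [CommRing L]
    {p : MvPolynomial σ R} {n : ℕ} (hp : p.IsHomogeneous n) (f : R →+* L) (u : L) (y : σ → L) :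
    eval₂ f (fun j => u * y j) p = u ^ n * eval₂ f y p := by
  rw [eval₂_eq', eval₂_eq', Finset.mul_sum]
  refine Finset.sum_congr rfl fun d hd => ?_
  have h : ∑ i, d i = n := by
    have := hp (mem_support_iff.1 hd)
    rwa [show Finsupp.weight 1 d = d.degree from
      (DFunLike.congr_fun (Finsupp.degree_eq_weight_one (R := ℕ)) d).symm,
      Finsupp.degree_eq_sum] at this
  rw [← h]
  simp only [mul_pow, Finset.prod_mul_distrib, Finset.prod_pow_eq_pow_sum]
  ring

/-- The ring of functions on a standard chart of projective space is a polynomial ring: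
dehomogenization is inverse to `x_j ↦ x_j / x_i`. -/
lemma nonempty_ringEquiv_away (n : ℕ) (i : Fin (n + 1))
    [GradedAlgebra (homogeneousSubmodule (Fin (n + 1)) ℤ)] :
    Nonempty (MvPolynomial (Fin n) ℤ ≃+*
      HomogeneousLocalization.Away (homogeneousSubmodule (Fin (n + 1)) ℤ) (X i)) := by
  let 𝒜 := homogeneousSubmodule (Fin (n + 1)) ℤ
  have hX (j : Fin (n + 1)) : (X j : MvPolynomial (Fin (n + 1)) ℤ) ∈ 𝒜 1 :=
    (mem_homogeneousSubmodule _ _).2 (isHomogeneous_X _ _)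
  let L := Localization.Away (X i : MvPolynomial (Fin (n + 1)) ℤ)
  let φ : MvPolynomial (Fin n) ℤ →+* HomogeneousLocalization.Away 𝒜 (X i) :=
    eval₂Hom (Int.castRingHom _) fun j => HomogeneousLocalization.Away.mk 𝒜 (hX i) 1
      (X (i.succAbove j)) (by simpa using hX (i.succAbove j))
  -- dehomogenization
  let δ : MvPolynomial (Fin (n + 1)) ℤ →+* MvPolynomial (Fin n) ℤ :=
    eval₂Hom (Int.castRingHom _) (i.insertNth 1 X)
  have hδ : δ (X i) = 1 := by
    simp [δ]
  let ψ : HomogeneousLocalization.Away 𝒜 (X i) →+* MvPolynomial (Fin n) ℤ :=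
    (IsLocalization.Away.lift (S := L) (X i) (g := δ) (by rw [hδ]; exact isUnit_one)).comp
      (algebraMap _ L)
  have hψ (m : ℕ) (a) (ha : a ∈ 𝒜 (m • 1)) :
      ψ (HomogeneousLocalization.Away.mk 𝒜 (hX i) m a ha) = δ a := by
    change IsLocalization.Away.lift (S := L) (X i) (g := δ) (by rw [hδ]; exact isUnit_one)
      (Localization.mk a ⟨X i ^ m, m, rfl⟩) = _
    rw [Localization.mk_eq_mk']
    refine (IsLocalization.lift_mk'_spec _ _ _ _).2 ?_
    simp [hδ]
  have hval (q : MvPolynomial (Fin n) ℤ) : (φ q).val = eval₂ (Int.castRingHom L)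
      (fun j => Localization.mk (X (i.succAbove j)) ⟨X i ^ 1, 1, rfl⟩) q := by
    have : (algebraMap _ L).comp φ = eval₂Hom (Int.castRingHom L)
      (fun j => Localization.mk (X (i.succAbove j)) ⟨X i ^ 1, 1, rfl⟩) := by
      apply ringHom_ext
      · intro r; simp
      · intro j
        rw [RingHom.comp_apply, eval₂Hom_X', eval₂Hom_X']
        rfl
    exact congrArg (fun g => g q) this
  refine ⟨RingEquiv.ofRingHom φ ψ ?_ ?_⟩
  · ext z
    obtain ⟨m, a, ha, rfl⟩ := HomogeneousLocalization.Away.mk_surjective 𝒜 (hX i) z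
    rw [RingHom.comp_apply, hψ, hval, RingHom.id_apply, HomogeneousLocalization.Away.val_mk]
    let y : Fin (n + 1) → L := i.insertNth 1
      fun j => Localization.mk (X (i.succAbove j)) ⟨X i ^ 1, 1, rfl⟩
    have h1 : eval₂ (Int.castRingHom L)
        (fun j => Localization.mk (X (i.succAbove j)) ⟨X i ^ 1, 1, rfl⟩) (δ a) =
        eval₂ (Int.castRingHom L) y a := by
      have : (eval₂Hom (Int.castRingHom L)
        (fun j => Localization.mk (X (i.succAbove j)) ⟨X i ^ 1, 1, rfl⟩)).comp δ =
          eval₂Hom (Int.castRingHom L) y := by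
        apply ringHom_ext
        · intro r; simp
        · intro j
          refine Fin.succAboveCases i ?_ (fun j => ?_) j
          · simp [δ, y]
          · simp [δ, y]
      exact congrArg (fun g => g a) this
    have h2 : eval₂ (Int.castRingHom L)
        (fun j => algebraMap (MvPolynomial (Fin (n + 1)) ℤ) L (X i) * y j) a =
        algebraMap _ L a := by
      have : eval₂Hom (Int.castRingHom L)
          (fun j => algebraMap (MvPolynomial (Fin (n + 1)) ℤ) L (X i) * y j) =
          algebraMap (MvPolynomial (Fin (n + 1)) ℤ) L := by
        apply ringHom_ext
        · intro r; simp
        · intro j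
          rw [eval₂Hom_X']
          refine Fin.succAboveCases i ?_ (fun j => ?_) j
          · simp [y]
          · simp only [y, Fin.insertNth_apply_succAbove]
            rw [Localization.mk_eq_mk', IsLocalization.mul_mk'_eq_mk'_of_mul,
              IsLocalization.mk'_eq_iff_eq_mul, ← map_mul]
            simp [mul_comm]
      exact congrArg (fun g => g a) this
    rw [h1, Localization.mk_eq_mk']
    refine (IsLocalization.eq_mk'_iff_mul_eq).2 ?_
    rw [← h2, eval₂_mul_of_isHomogeneous ((mem_homogeneousSubmodule _ _).1 ha), smul_eq_mul,
      mul_one, mul_comm, map_pow]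
  · apply ringHom_ext
    · intro r; simp
    · intro j
      rw [RingHom.comp_apply]
      have : φ (X j) = HomogeneousLocalization.Away.mk 𝒜 (hX i) 1
        (X (i.succAbove j)) (by simpa using hX (i.succAbove j)) := eval₂Hom_X' _ _ _
      rw [this, hψ]
      simp [δ]

/-- A scheme is covered by affine spaces over `ℤ`. -/
def IsCoveredByAffineSpaces (Y : Scheme.{0}) : Prop :=
  ∀ y : Y, ∃ V : Y.Opens, IsAffineOpen V ∧ y ∈ V ∧
    ∃ N : ℕ, Nonempty (MvPolynomial (Fin N) ℤ ≃+* Γ(Y, V))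

lemma isCoveredByAffineSpaces_projectiveSpace (n : ℕ) :
    IsCoveredByAffineSpaces (projectiveSpace n) := by
  let _ := MvPolynomial.gradedAlgebra (σ := Fin (n + 1)) (R := ℤ)
  let 𝒜 := homogeneousSubmodule (Fin (n + 1)) ℤ
  have hX (j : Fin (n + 1)) : (X j : MvPolynomial (Fin (n + 1)) ℤ) ∈ 𝒜 1 :=
    (mem_homogeneousSubmodule _ _).2 (isHomogeneous_X _ _)
  intro y
  have htop : ⨆ i, Proj.basicOpen 𝒜 (X i) = ⊤ := by
    refine Proj.iSup_basicOpen_eq_top' 𝒜 _ (fun i => ⟨1, hX i⟩) (top_le_iff.1 fun p _ => ?_)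
    induction p using MvPolynomial.induction_on with
    | C r => rw [eq_intCast]; exact intCast_mem _ r
    | add p q hp hq => exact add_mem (hp trivial) (hq trivial)
    | mul_X p i hp => exact mul_mem (hp trivial) (Algebra.subset_adjoin ⟨i, rfl⟩)
  have hy : (y : Proj 𝒜) ∈ ⨆ i, Proj.basicOpen 𝒜 (X i) := by rw [htop]; trivial
  obtain ⟨i, hi⟩ := Opens.mem_iSup.1 hy
  obtain ⟨e⟩ := nonempty_ringEquiv_away n i
  exact ⟨Proj.basicOpen 𝒜 (X i), Proj.isAffineOpen_basicOpen 𝒜 _ (hX i) one_pos, hi, n,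
    ⟨e.trans (Proj.basicOpenIsoAway 𝒜 _ (hX i) one_pos).commRingCatIsoToRingEquiv⟩⟩

end ProjectiveSpace

/-! ### Products -/

section Product

lemma hom_ext_sections_specInt {R : CommRingCat.{0}} (a b : Γ(Spec (.of ℤ), ⊤) ⟶ R) : a = b := by
  rw [← cancel_epi (Scheme.ΓSpecIso (.of ℤ)).inv]
  ext : 1
  exact RingHom.ext_int _ _

variable {P Y₁ Y₂ : Scheme.{0}} {p₁ : P ⟶ Y₁} {p₂ : P ⟶ Y₂} {s₁ : Y₁ ⟶ Spec (.of ℤ)}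
  {s₂ : Y₂ ⟶ Spec (.of ℤ)} (H : IsPullback p₁ p₂ s₁ s₂) {V₁ : Y₁.Opens} {V₂ : Y₂.Opens}
  {V : P.Opens} (hV : V = p₁ ⁻¹ᵁ V₁ ⊓ p₂ ⁻¹ᵁ V₂)
include H

/-- `V₁ × V₂` is affine. -/
lemma isAffineOpen_inf_preimage (h₁ : IsAffineOpen V₁) (h₂ : IsAffineOpen V₂)
    (hV : V = p₁ ⁻¹ᵁ V₁ ⊓ p₂ ⁻¹ᵁ V₂) : IsAffineOpen V := by
  have : IsAffine _ := h₁
  have : IsAffine _ := h₂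
  have : IsAffine _ := isAffineOpen_top (Spec (.of ℤ))
  exact .of_isIso (Scheme.Hom.isPullback_resLE H (US := ⊤) le_top le_top hV).isoPullback.hom

/-- Functions on a product of affine open sets: homomorphisms out of `Γ(P, V)` are the same as pairs
of homomorphisms out of `Γ(Y₁, V₁)` and `Γ(Y₂, V₂)`. -/
lemma isPushout_sections (h₁ : IsAffineOpen V₁) (h₂ : IsAffineOpen V₂) :
    IsPushout (s₁.appLE ⊤ V₁ le_top) (s₂.appLE ⊤ V₂ le_top)
      (p₁.appLE V₁ V (hV.le.trans inf_le_left)) (p₂.appLE V₂ V (hV.le.trans inf_le_right)) :=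
  (isIso_pushoutSection_iff H (US := ⊤) le_top le_top hV).1
    (isIso_pushoutSection_of_isAffineOpen H le_top le_top hV (isAffineOpen_top _) h₂ h₁)

lemma ringHom_ext_sections (h₁ : IsAffineOpen V₁) (h₂ : IsAffineOpen V₂) {R : Type} [CommRing R]
    {α β : Γ(P, V) →+* R}
    (e₁ : ∀ a, α (p₁.appLE V₁ V (hV.le.trans inf_le_left) a) =
      β (p₁.appLE V₁ V (hV.le.trans inf_le_left) a))
    (e₂ : ∀ a, α (p₂.appLE V₂ V (hV.le.trans inf_le_right) a) =
      β (p₂.appLE V₂ V (hV.le.trans inf_le_right) a)) : α = β := by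
  have h := isPushout_sections H hV h₁ h₂
  have : CommRingCat.ofHom α = CommRingCat.ofHom β := by
    apply h.hom_ext
    · ext a; exact e₁ a
    · ext a; exact e₂ a
  exact congrArg CommRingCat.Hom.hom this

lemma exists_ringHom_sections (h₁ : IsAffineOpen V₁) (h₂ : IsAffineOpen V₂) {R : Type} [CommRing R]
    (α : Γ(Y₁, V₁) →+* R) (β : Γ(Y₂, V₂) →+* R) : ∃ γ : Γ(P, V) →+* R,
      (∀ a, γ (p₁.appLE V₁ V (hV.le.trans inf_le_left) a) = α a) ∧
      ∀ a, γ (p₂.appLE V₂ V (hV.le.trans inf_le_right) a) = β a := by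
  have h := isPushout_sections H hV h₁ h₂
  have w := hom_ext_sections_specInt (s₁.appLE ⊤ V₁ le_top ≫ CommRingCat.ofHom α)
    (s₂.appLE ⊤ V₂ le_top ≫ CommRingCat.ofHom β)
  refine ⟨(h.desc _ _ w).hom, fun a => ?_, fun a => ?_⟩
  · exact ConcreteCategory.congr_hom (h.inl_desc _ _ w) a
  · exact ConcreteCategory.congr_hom (h.inr_desc _ _ w) a

/-- A product of affine spaces is an affine space. -/
lemma isCoveredByAffineSpaces_of_isPullback (c₁ : IsCoveredByAffineSpaces Y₁)
    (c₂ : IsCoveredByAffineSpaces Y₂) : IsCoveredByAffineSpaces P := by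
  intro y
  obtain ⟨V₁, h₁, hy₁, N₁, ⟨e₁⟩⟩ := c₁ (p₁ y)
  obtain ⟨V₂, h₂, hy₂, N₂, ⟨e₂⟩⟩ := c₂ (p₂ y)
  let V := p₁ ⁻¹ᵁ V₁ ⊓ p₂ ⁻¹ᵁ V₂
  have hV : V = p₁ ⁻¹ᵁ V₁ ⊓ p₂ ⁻¹ᵁ V₂ := rfl
  refine ⟨V, isAffineOpen_inf_preimage H h₁ h₂ hV, ⟨hy₁, hy₂⟩, N₁ + N₂, ⟨?_⟩⟩
  let q₁ := (p₁.appLE V₁ V (hV.le.trans inf_le_left)).hom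
  let q₂ := (p₂.appLE V₂ V (hV.le.trans inf_le_right)).hom
  let Θ : MvPolynomial (Fin N₁ ⊕ Fin N₂) ℤ →+* Γ(P, V) :=
    MvPolynomial.eval₂Hom (Int.castRingHom _)
      (Sum.elim (fun l => q₁ (e₁ (.X l))) fun l => q₂ (e₂ (.X l)))
  have hΘ₁ (a) : Θ (MvPolynomial.rename Sum.inl a) = q₁ (e₁ a) := by
    have : Θ.comp (MvPolynomial.rename (R := ℤ) Sum.inl).toRingHom =
        q₁.comp (e₁ : _ →+* Γ(Y₁, V₁)) := by
      apply MvPolynomial.ringHom_ext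
      · intro r; simp
      · intro l; simp [Θ]
    exact congrArg (fun g => g a) this
  have hΘ₂ (a) : Θ (MvPolynomial.rename Sum.inr a) = q₂ (e₂ a) := by
    have : Θ.comp (MvPolynomial.rename (R := ℤ) Sum.inr).toRingHom =
        q₂.comp (e₂ : _ →+* Γ(Y₂, V₂)) := by
      apply MvPolynomial.ringHom_ext
      · intro r; simp
      · intro l; simp [Θ]
    exact congrArg (fun g => g a) this
  choose Ψ hΨ₁ hΨ₂ using exists_ringHom_sections H hV h₁ h₂
    ((MvPolynomial.rename (R := ℤ) (Sum.inl : Fin N₁ → Fin N₁ ⊕ Fin N₂)).toRingHom.comp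
      (e₁.symm : Γ(Y₁, V₁) →+* _))
    ((MvPolynomial.rename (R := ℤ) (Sum.inr : Fin N₂ → Fin N₁ ⊕ Fin N₂)).toRingHom.comp
      (e₂.symm : Γ(Y₂, V₂) →+* _))
  refine (MvPolynomial.renameEquiv ℤ finSumFinEquiv.symm).toRingEquiv.trans
    (RingEquiv.ofRingHom Θ Ψ ?_ ?_)
  · refine ringHom_ext_sections H hV h₁ h₂ (fun a => ?_) fun a => ?_
    · rw [RingHom.comp_apply, hΨ₁]
      refine (hΘ₁ _).trans ?_
      simp [q₁]
    · rw [RingHom.comp_apply, hΨ₂]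
      refine (hΘ₂ _).trans ?_
      simp [q₂]
  · apply MvPolynomial.ringHom_ext
    · intro r; simp
    · rintro (l | l)
      · have : Θ (.X (Sum.inl l)) = q₁ (e₁ (.X l)) := MvPolynomial.eval₂Hom_X' _ _ _
        rw [RingHom.comp_apply, this, hΨ₁]
        simp
      · have : Θ (.X (Sum.inr l)) = q₂ (e₂ (.X l)) := MvPolynomial.eval₂Hom_X' _ _ _
        rw [RingHom.comp_apply, this, hΨ₂]
        simp

/-- The first projection of a product induces a quasi-isomorphism of the two-term complexes of
`𝒪_X`-modules. The second projection lifts locally along `X ⟶ Y₁`, as the functions on a chart of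
`Y₂` form a polynomial ring; this yields the sections of the first projection that
`isHomExact_of_retraction` asks for. -/
lemma quasiIso_transition_of_isPullback {X : Scheme.{0}} (k : X ⟶ P) {i : X ⟶ Y₁}
    [IsAffineHom k] [IsClosedImmersion i] (h : k ≫ p₁ = i) (hk : HasLocallyFreeTerms k)
    (hi : HasLocallyFreeTerms i) (c₁ : IsCoveredByAffineSpaces Y₁)
    (c₂ : IsCoveredByAffineSpaces Y₂) : quasiIso X (transition k p₁ h hk hi) := by
  subst h
  refine quasiIso_transitionAux k p₁ hk hi fun x => ?_
  obtain ⟨U₁, hU₁, hx₁, -⟩ := c₁ ((k ≫ p₁) x)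
  obtain ⟨W, hW, hx₂, N, ⟨e⟩⟩ := c₂ ((k ≫ p₂) x)
  obtain ⟨O, hO, hOW⟩ := (k ≫ p₁).isClosedEmbedding.isInducing.isOpen_iff.1
    ((k ≫ p₂) ⁻¹ᵁ W).isOpen
  obtain ⟨f, hf, hxf⟩ := hU₁.exists_basicOpen_le (V := ⟨O, hO⟩)
    ⟨(k ≫ p₁) x, show x ∈ (k ≫ p₁) ⁻¹' O by rw [hOW]; exact hx₂⟩ hx₁
  let V := Y₁.basicOpen f
  have hV : IsAffineOpen V := hU₁.basicOpen f
  let T := (k ≫ p₁) ⁻¹ᵁ V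
  have hTW : T ≤ (k ≫ p₂) ⁻¹ᵁ W := fun y hy => by
    have : y ∈ (k ≫ p₁) ⁻¹' O := hf hy
    rw [hOW] at this
    exact this
  let V' := p₁ ⁻¹ᵁ V ⊓ p₂ ⁻¹ᵁ W
  have hV' : V' = p₁ ⁻¹ᵁ V ⊓ p₂ ⁻¹ᵁ W := rfl
  have hT : k ⁻¹ᵁ V' = T := inf_eq_left.2 hTW
  -- lift the second projection along the surjection from functions on `V` to functions on `T`
  have hlift (l : Fin N) :=
    (k ≫ p₁).app_surjective V hV ((k ≫ p₂).appLE W T hTW (e (.X l)))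
  choose y hy using hlift
  let lam : Γ(Y₂, W) →+* Γ(Y₁, V) :=
    (MvPolynomial.eval₂Hom (Int.castRingHom _) y).comp (e.symm : Γ(Y₂, W) →+* _)
  have hlam (w) : (k ≫ p₁).app V (lam w) = (k ≫ p₂).appLE W T hTW w := by
    obtain ⟨w, rfl⟩ := e.surjective w
    have : (((k ≫ p₁).app V).hom.comp lam).comp (e : MvPolynomial (Fin N) ℤ →+* Γ(Y₂, W)) =
        ((k ≫ p₂).appLE W T hTW).hom.comp (e : MvPolynomial (Fin N) ℤ →+* Γ(Y₂, W)) := by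
      apply MvPolynomial.ringHom_ext
      · intro r
        rw [eq_intCast, map_intCast, map_intCast]
      · intro l
        simp only [RingHom.comp_apply, lam, RingEquiv.coe_toRingHom, RingEquiv.symm_apply_apply,
          MvPolynomial.eval₂Hom_X']
        exact hy l
    exact congrArg (fun g => g w) this
  obtain ⟨s, hs₁, hs₂⟩ := exists_ringHom_sections H hV' hV hW (RingHom.id _) lam
  refine ⟨T, hxf, fun N => isHomExact_of_retraction k p₁ hV
    (isAffineOpen_inf_preimage H hV hW hV') inf_le_left hT rfl s hs₁ (fun b => ?_)
    (supportedOn_pushforward_ι T N)⟩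
  have : ((k ≫ p₁).appLE V T le_rfl).hom.comp s = (k.appLE V' T hT.ge).hom := by
    refine ringHom_ext_sections H hV' hV hW (fun a => ?_) fun a => ?_
    · rw [RingHom.comp_apply, hs₁]
      change (k ≫ p₁).appLE V T le_rfl a = k.appLE V' T hT.ge (p₁.appLE V V' _ a)
      rw [← ConcreteCategory.comp_apply, Scheme.Hom.appLE_comp_appLE]
    · rw [RingHom.comp_apply, hs₂]
      change (k ≫ p₁).appLE V T le_rfl (lam a) = k.appLE V' T hT.ge (p₂.appLE W V' _ a)
      rw [← ConcreteCategory.comp_apply, Scheme.Hom.appLE_comp_appLE, Scheme.Hom.appLE_eq_app]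
      exact hlam a
  exact congrArg (fun g => g b) this

end Product

/-! ### Comparison of two embeddings -/

section Main
variable {X Y : Scheme.{0}}

/-- Polynomial rings over `ℤ` are regular, and their differentials are free. -/
lemma hasLocallyFreeTerms_of_isCoveredByAffineSpaces (k : X ⟶ Y) [IsClosedImmersion k]
    (hreg : IsRegularScheme X) (hY : IsCoveredByAffineSpaces Y) : HasLocallyFreeTerms k where
  conormal := isVectorBundle_conormal k hreg fun x => by
    obtain ⟨V, hV, hx, N, ⟨e⟩⟩ := hY (k x)
    have : IsRegularRing (MvPolynomial (Fin N) ℤ) := MvPolynomial.isRegularRing_of_isRegularRing ℤ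
    exact ⟨V, hV, hx, IsRegularRing.of_ringEquiv e⟩
  differentials := isVectorBundle_restrictedDifferentials k fun x => hY (k x)

instance isSeparated_projectiveSpace (n : ℕ) : (projectiveSpace n).IsSeparated := by
  let _ := MvPolynomial.gradedAlgebra (σ := Fin (n + 1)) (R := ℤ)
  exact inferInstanceAs (Proj (MvPolynomial.homogeneousSubmodule (Fin (n + 1)) ℤ)).IsSeparated

lemma isIso_derivedTransition {P Z : Scheme.{0}} (k : X ⟶ P) (p : P ⟶ Z) {i : X ⟶ Z} (h : k ≫ p = i)
    (hk : HasLocallyFreeTerms k) (hi : HasLocallyFreeTerms i)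
    (hq : quasiIso X (transition k p h hk hi)) : IsIso (derivedTransition k p h hk hi) :=
  MorphismProperty.Q_inverts (quasiIso X) _ hq

lemma derivedTransition_congr {k : X ⟶ Y} {Z : Scheme.{0}} {f f' : Y ⟶ Z} (e : f = f') {i : X ⟶ Z}
    (h : k ≫ f = i) (h' : k ≫ f' = i) (hk : HasLocallyFreeTerms k) (hi : HasLocallyFreeTerms i) :
    derivedTransition k f h hk hi = derivedTransition k f' h' hk hi := by
  subst e
  rfl

end Main

end

end CotangentZ

theorem propositionB1 (X : Scheme.{0}) (hreg : CotangentZ.IsRegularScheme X)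
    (hproj : CotangentZ.IsProjectiveOverInt X) :
    ∃ hfree : ∀ (n : ℕ) (i : X ⟶ CotangentZ.projectiveSpace n), IsClosedImmersion i →
        CotangentZ.HasLocallyFreeTerms i,
      ∀ (n m : ℕ) (i : X ⟶ CotangentZ.projectiveSpace n) (j : X ⟶ CotangentZ.projectiveSpace m)
        (hi : IsClosedImmersion i) (hj : IsClosedImmersion j),
        ∃! e : CotangentZ.cotangentObject i (hfree n i hi) ≅
            CotangentZ.cotangentObject j (hfree m j hj),
          ∀ (Y : Scheme.{0}) (k : X ⟶ Y) (f : Y ⟶ CotangentZ.projectiveSpace n)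
            (g : Y ⟶ CotangentZ.projectiveSpace m) (hf : k ≫ f = i) (hg : k ≫ g = j)
            (_ : IsClosedImmersion k) (hk : CotangentZ.HasLocallyFreeTerms k),
            e.hom ≫ CotangentZ.derivedTransition k g hg hk (hfree m j hj) =
              CotangentZ.derivedTransition k f hf hk (hfree n i hi) := by
  open CotangentZ in
  refine ⟨fun n i hi => hasLocallyFreeTerms_of_isCoveredByAffineSpaces i hreg
    (isCoveredByAffineSpaces_projectiveSpace n), fun n m i j hi hj => ?_⟩
  have cn := isCoveredByAffineSpaces_projectiveSpace n
  have cm := isCoveredByAffineSpaces_projectiveSpace m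
  have hfi := hasLocallyFreeTerms_of_isCoveredByAffineSpaces i hreg cn
  have hfj := hasLocallyFreeTerms_of_isCoveredByAffineSpaces j hreg cm
  -- `P = ℙⁿ × ℙᵐ`, with `X` embedded by `(i, j)`
  let s₁ := specZIsTerminal.from (projectiveSpace n)
  let s₂ := specZIsTerminal.from (projectiveSpace m)
  have H : IsPullback (pullback.fst s₁ s₂) (pullback.snd s₁ s₂) s₁ s₂ := .of_hasPullback s₁ s₂
  let k₀ : X ⟶ pullback s₁ s₂ := pullback.lift i j (specZIsTerminal.hom_ext _ _)
  have h₁ : k₀ ≫ pullback.fst s₁ s₂ = i := pullback.lift_fst _ _ _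
  have h₂ : k₀ ≫ pullback.snd s₁ s₂ = j := pullback.lift_snd _ _ _
  have hk₀ : IsClosedImmersion k₀ := by
    have : IsClosedImmersion (k₀ ≫ pullback.fst s₁ s₂) := by rw [h₁]; exact hi
    exact IsClosedImmersion.of_comp k₀ (pullback.fst s₁ s₂)
  have hf₀ := hasLocallyFreeTerms_of_isCoveredByAffineSpaces k₀ hreg
    (isCoveredByAffineSpaces_of_isPullback H cn cm)
  have iso₁ : IsIso (derivedTransition k₀ (pullback.fst s₁ s₂) h₁ hf₀ hfi) :=
    isIso_derivedTransition _ _ _ _ _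
      (quasiIso_transition_of_isPullback H k₀ h₁ hf₀ hfi cn cm)
  have iso₂ : IsIso (derivedTransition k₀ (pullback.snd s₁ s₂) h₂ hf₀ hfj) :=
    isIso_derivedTransition _ _ _ _ _
      (quasiIso_transition_of_isPullback H.flip k₀ h₂ hf₀ hfj cm cn)
  refine ⟨asIso (derivedTransition k₀ (pullback.fst s₁ s₂) h₁ hf₀ hfi) ≪≫
    (asIso (derivedTransition k₀ (pullback.snd s₁ s₂) h₂ hf₀ hfj)).symm, ?_, ?_⟩
  · intro Y k f g hf hg _ hk
    -- every `(Y, k, f, g)` maps to the product by `(f, g)`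
    let h : Y ⟶ pullback s₁ s₂ := pullback.lift f g (specZIsTerminal.hom_ext _ _)
    have hh₁ : h ≫ pullback.fst s₁ s₂ = f := pullback.lift_fst _ _ _
    have hh₂ : h ≫ pullback.snd s₁ s₂ = g := pullback.lift_snd _ _ _
    have hkh : k ≫ h = k₀ := by
      apply pullback.hom_ext
      · rw [Category.assoc, hh₁, hf, h₁]
      · rw [Category.assoc, hh₂, hg, h₂]
    have e₁ : derivedTransition k f hf hk hfi =
        derivedTransition k₀ (pullback.fst s₁ s₂) h₁ hf₀ hfi ≫ derivedTransition k h hkh hk hf₀ :=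
      (derivedTransition_congr hh₁.symm hf (by rw [hh₁, hf]) hk hfi).trans
        (derivedTransition_comp hkh h₁ _ hk hf₀ hfi)
    have e₂ : derivedTransition k g hg hk hfj =
        derivedTransition k₀ (pullback.snd s₁ s₂) h₂ hf₀ hfj ≫ derivedTransition k h hkh hk hf₀ :=
      (derivedTransition_congr hh₂.symm hg (by rw [hh₂, hg]) hk hfj).trans
        (derivedTransition_comp hkh h₂ _ hk hf₀ hfj)
    rw [e₁, e₂]
    simp
  · intro e he
    -- uniqueness: apply the property to the product itself and its two projections
    have := he _ k₀ (pullback.fst s₁ s₂) (pullback.snd s₁ s₂) h₁ h₂ hk₀ hf₀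
    ext1
    rw [Iso.trans_hom, asIso_hom, Iso.symm_hom, asIso_inv, IsIso.eq_comp_inv]
    exact this
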